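/- Consider $M$ agents $x^i_{k+1}=Ax^i_k+Bu^i_k$ with $x^i_k\in\mathbb R^n$, $u^i_k\in\mathbb R^m$ and input constraints $u^i_k\in\mathcal U^i$, where each $\mathcal U^i$ is compact with $0$ in its interior. Assume that $(A,B)$ is controllable, that $B$ has full column rank, and that $A$ is semi-stable (its spectral radius is at most $1$ and, if it equals $1$, then $1$ is a simple eigenvalue). The agents communicate over a fixed directed graph without self-loops, with unit weights, that contains a spanning tree; $\mathcal L$ is its (in-degree) Laplacian. Write $X_k=\mathrm{col}(x^1_k,\dots,x^M_k)$, $U_k=\mathrm{col}(u^1_k,\dots,u^M_k)$, $\mathcal U=\mathcal U^1\times\cdots\times\mathcal U^M$ and $\|x\|_P=\sqrt{x^{\mathrm T}Px}$. Let the design parameters satisfy: 1) $Q_2=C_2^{\mathrm T}C_2$ with $(C_2,A)$ semi-observable, i.e. $\ker(A-I_n)=\bigcap_{i=0}^{n-1}\ker(C_2(A-I_n)^i)$, and $\operatorname{rank}C_2=n-1$; 2) $S_2$ is symmetric positive definite with $A^{\mathrm T}S_2A-S_2=-C_2^{\mathrm T}C_2$; 3) $S_1=W\mathcal L$ with $W$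 symmetric positive definite and $W\mathcal L$, $W\mathcal L^2$ symmetric; 4) $R_1=\frac{1}{c\alpha}W(I_M-c\mathcal L)$; 5) $R_2=\alpha B^{\mathrm T}S_2B$ with $\alpha>0$; 6) $c>0$ and $c\le 1/\sigma_{\max}(\mathcal L)$, where $\sigma_{\max}(\mathcal L)$ is the largest nonzero eigenvalue of $\mathcal L$ (no upper bound if $M=1$). Put $H=A^{\mathrm T}S_2B(B^{\mathrm T}S_2B)^{-1}B^{\mathrm T}S_2A$, $Q_s=S_1\otimes Q_2+\frac{c\,S_1\mathcal L}{1+\alpha}\otimes H$, $R_s=R_1\otimes R_2$, $S_s=S_1\otimes S_2$, $K_2=-(B^{\mathrm T}S_2B+R_2)^{-1}B^{\mathrm T}S_2A$, $K^*=c\,\mathcal L\otimes K_2$. Let $\beta_s>0$ be such that $K^*X\in\mathcal U$ for every $X$ in the terminal set $\mathcal O_{\beta_s}=\{X:\|X\|_{S_s}\le\beta_s\}$, and let $N\ge1$ be the prediction horizon. For a state $X_k$ consider the problem of minimizing $$\sum_{l=0}^{N-1}\bigl(\|X_{k+l|k}\|_{Q_s}^2+\|U_{k+l|k}\|_{R_s}^2\bigr)+\|X_{k+N|k}\|_{S_s}^2$$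 subject to $X_{k|k}=X_k$, $X_{k+l+1|k}=(I_M\otimes A)X_{k+l|k}+(I_M\otimes B)U_{k+l|k}$ and $U_{k+l|k}\in\mathcal U$ for $l=0,\dots,N-1$, and $X_{k+N|k}\in\mathcal O_{\beta_s}$. The receding-horizon (RHC) law applies at time $k$ the first input $U_k=U^*_{k|k}$ of an optimal solution (any one, if there are several). Then, for every initial state $X_0$ at which this problem is feasible, every closed loop $X_{k+1}=(I_M\otimes A)X_k+(I_M\otimes B)U_k$ under the RHC law has the following properties: the problem has an optimal solution at every time $k\ge0$ and $U_k$ is the first input of one; $u^i_k\in\mathcal U^i$ for all $k\ge0$ and all $i$; and the closed loop reaches convergent consensus, i.e. $\lim_{k\to\infty}\|x^i_k-x^j_k\|=0$ for all $i,j$, and for every $i$ the limit $\lim_{k\to\infty}\|x^i_k\|$ exists and is finite (so the states stay bounded). -/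

import Mathlib

open Filter Topology
open scoped Matrix Kronecker

noncomputable section

namespace RHCConsensus

/-! ### Communication graphs -/

open Classical in
/-- Adjacency matrix with unit weights: `a i j = 1` iff `(j, i)` is an edge (`j` sends to `i`). -/
def adjMat {M : ℕ} (G : Digraph (Fin M)) : Matrix (Fin M) (Fin M) ℝ :=
  Matrix.of fun i j => if G.Adj j i then 1 else 0

/-- Graph Laplacian `D - A`, where `D` is the diagonal matrix of in-degrees. -/
def laplacian {M : ℕ} (G : Digraph (Fin M)) : Matrix (Fin M) (Fin M) ℝ :=
  Matrix.diagonal (fun i => ∑ j, adjMat G i j) - adjMat G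

/-- Some root node is connected to every node by a directed path. -/
def HasSpanningTree {M : ℕ} (G : Digraph (Fin M)) : Prop :=
  ∃ r, ∀ i, Relation.ReflTransGen G.Adj r i

/-! ### Properties of the agent dynamics -/

/-- Kalman rank condition: `[B, AB, …, Aⁿ⁻¹B]` has rank `n`. -/
def IsControllable {n m : ℕ} (A : Matrix (Fin n) (Fin n) ℝ) (B : Matrix (Fin n) (Fin m) ℝ) : Prop :=
  (Matrix.of fun (a : Fin n) (q : Fin n × Fin m) => (A ^ (q.1 : ℕ) * B) a q.2).rank = n

/-- The spectral radius is at most `1`; if it equals `1`, then `1` is a simple eigenvalue. -/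
def IsSemistable {n : ℕ} (A : Matrix (Fin n) (Fin n) ℝ) : Prop :=
  (∀ z ∈ spectrum ℂ (A.map (algebraMap ℝ ℂ)), ‖z‖ ≤ 1) ∧
  ((∃ z ∈ spectrum ℂ (A.map (algebraMap ℝ ℂ)), ‖z‖ = 1) → A.charpoly.rootMultiplicity 1 = 1)

/-- `Ker (A - I) = ⋂_{i < n} Ker (C (A - I)^i)`. -/
def IsSemiObservable {n p : ℕ} (C : Matrix (Fin p) (Fin n) ℝ) (A : Matrix (Fin n) (Fin n) ℝ) :
    Prop :=
  ∀ v : Fin n → ℝ, (A - 1) *ᵥ v = 0 ↔ ∀ i : Fin n, (C * (A - 1) ^ (i : ℕ)) *ᵥ v = 0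

/-! ### Design parameters -/

/-- `H = Aᵀ S₂ B (Bᵀ S₂ B)⁻¹ Bᵀ S₂ A`. -/
def matH {n m : ℕ} (A : Matrix (Fin n) (Fin n) ℝ) (B : Matrix (Fin n) (Fin m) ℝ)
    (S₂ : Matrix (Fin n) (Fin n) ℝ) : Matrix (Fin n) (Fin n) ℝ :=
  Aᵀ * S₂ * B * (Bᵀ * S₂ * B)⁻¹ * Bᵀ * S₂ * A

/-- `R₂ = α Bᵀ S₂ B`. -/
def matR2 {n m : ℕ} (B : Matrix (Fin n) (Fin m) ℝ) (S₂ : Matrix (Fin n) (Fin n) ℝ) (α : ℝ) :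
    Matrix (Fin m) (Fin m) ℝ :=
  α • (Bᵀ * S₂ * B)

/-- Consensus gain `K₂ = -(Bᵀ S₂ B + R₂)⁻¹ Bᵀ S₂ A`. -/
def matK2 {n m : ℕ} (A : Matrix (Fin n) (Fin n) ℝ) (B : Matrix (Fin n) (Fin m) ℝ)
    (S₂ : Matrix (Fin n) (Fin n) ℝ) (α : ℝ) : Matrix (Fin m) (Fin n) ℝ :=
  -((Bᵀ * S₂ * B + matR2 B S₂ α)⁻¹ * Bᵀ * S₂ * A)

/-- `S₁ = W L`. -/
def matS1 {M : ℕ} (W L : Matrix (Fin M) (Fin M) ℝ) : Matrix (Fin M) (Fin M) ℝ := W * L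

/-- `R₁ = W (I - c L) / (c α)`. -/
def matR1 {M : ℕ} (W L : Matrix (Fin M) (Fin M) ℝ) (c α : ℝ) : Matrix (Fin M) (Fin M) ℝ :=
  (1 / (c * α)) • (W * (1 - c • L))

/-- State weight `Q_s = S₁ ⊗ Q₂ + (c S₁ L / (1 + α)) ⊗ H`, with `Q₂ = C₂ᵀ C₂`. -/
def matQs {M n m p : ℕ} (L W : Matrix (Fin M) (Fin M) ℝ) (A : Matrix (Fin n) (Fin n) ℝ)
    (B : Matrix (Fin n) (Fin m) ℝ) (C₂ : Matrix (Fin p) (Fin n) ℝ)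
    (S₂ : Matrix (Fin n) (Fin n) ℝ) (c α : ℝ) : Matrix (Fin M × Fin n) (Fin M × Fin n) ℝ :=
  matS1 W L ⊗ₖ (C₂ᵀ * C₂) + ((c / (1 + α)) • (matS1 W L * L)) ⊗ₖ matH A B S₂

/-- Input weight `R_s = R₁ ⊗ R₂`. -/
def matRs {M n m : ℕ} (L W : Matrix (Fin M) (Fin M) ℝ) (B : Matrix (Fin n) (Fin m) ℝ)
    (S₂ : Matrix (Fin n) (Fin n) ℝ) (c α : ℝ) : Matrix (Fin M × Fin m) (Fin M × Fin m) ℝ :=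
  matR1 W L c α ⊗ₖ matR2 B S₂ α

/-- Terminal weight `S_s = S₁ ⊗ S₂`. -/
def matSs {M n : ℕ} (L W : Matrix (Fin M) (Fin M) ℝ) (S₂ : Matrix (Fin n) (Fin n) ℝ) :
    Matrix (Fin M × Fin n) (Fin M × Fin n) ℝ :=
  matS1 W L ⊗ₖ S₂

/-- Overall gain `K* = c L ⊗ K₂`. -/
def matKstar {M n m : ℕ} (L : Matrix (Fin M) (Fin M) ℝ) (A : Matrix (Fin n) (Fin n) ℝ)
    (B : Matrix (Fin n) (Fin m) ℝ) (S₂ : Matrix (Fin n) (Fin n) ℝ) (c α : ℝ) :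
    Matrix (Fin M × Fin m) (Fin M × Fin n) ℝ :=
  (c • L) ⊗ₖ matK2 A B S₂ α

/-- The design conditions on `C₂, S₂, W, c, α` (those on `Q₂, S₁, R₁, R₂` are the definitions
above). `L` has real spectrum here, and the condition on `c` is `c ≤ 1 / σ_max(L)`, where
`σ_max(L)` is the largest nonzero eigenvalue; it is void if there is none (one agent). -/
structure DesignConditions {M n m p : ℕ} (L W : Matrix (Fin M) (Fin M) ℝ)
    (A : Matrix (Fin n) (Fin n) ℝ) (B : Matrix (Fin n) (Fin m) ℝ)
    (C₂ : Matrix (Fin p) (Fin n) ℝ) (S₂ : Matrix (Fin n) (Fin n) ℝ) (c α : ℝ) : Prop where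
  fullColumnRank : B.rank = m
  semiObservable : IsSemiObservable C₂ A
  rank_C₂ : C₂.rank + 1 = n
  posDef_S₂ : S₂.PosDef
  lyapunov : Aᵀ * S₂ * A - S₂ = -(C₂ᵀ * C₂)
  posDef_W : W.PosDef
  symm_WL : (W * L).IsSymm
  symm_WL2 : (W * L ^ 2).IsSymm
  α_pos : 0 < α
  c_pos : 0 < c
  c_le : ∀ μ ∈ spectrum ℝ L, μ ≠ 0 → c ≤ 1 / μ

/-! ### Finite-horizon optimal control problem and the receding-horizon law -/

/-- `‖x‖²_P = xᵀ P x`. -/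
def wsq {ι : Type*} [Fintype ι] (P : Matrix ι ι ℝ) (x : ι → ℝ) : ℝ := x ⬝ᵥ (P *ᵥ x)

/-- The level set `{X : ‖X‖_S ≤ β}`. -/
def levelSet {ι : Type*} [Fintype ι] (S : Matrix ι ι ℝ) (β : ℝ) : Set (ι → ℝ) :=
  {X | √(wsq S X) ≤ β}

/-- The product set `𝒰 = 𝒰¹ × ⋯ × 𝒰ᴹ` of stacked inputs. -/
def inputSet {M m : ℕ} (𝒰 : Fin M → Set (Fin m → ℝ)) : Set (Fin M × Fin m → ℝ) :=
  {U | ∀ i, (fun a => U (i, a)) ∈ 𝒰 i}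

/-- Constraints of the `N`-step problem from the current state `X`, on the predicted states
`x 0, …, x N` and the predicted inputs `u 0, …, u (N-1)`. -/
structure IsFeasible {ι κ : Type*} [Fintype ι] [Fintype κ] {N : ℕ} (F : Matrix ι ι ℝ)
    (E : Matrix ι κ ℝ) (𝒰 : Set (κ → ℝ)) (𝒪 : Set (ι → ℝ)) (X : ι → ℝ)
    (x : Fin (N + 1) → ι → ℝ) (u : Fin N → κ → ℝ) : Prop where
  init : x 0 = X
  dynamics : ∀ l : Fin N, x l.succ = F *ᵥ x l.castSucc + E *ᵥ u l
  input : ∀ l, u l ∈ 𝒰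
  terminal : x (Fin.last N) ∈ 𝒪

/-- `∑_{l<N} (‖x_l‖²_Q + ‖u_l‖²_R) + ‖x_N‖²_S`. -/
def cost {ι κ : Type*} [Fintype ι] [Fintype κ] {N : ℕ} (Q : Matrix ι ι ℝ) (R : Matrix κ κ ℝ)
    (S : Matrix ι ι ℝ) (x : Fin (N + 1) → ι → ℝ) (u : Fin N → κ → ℝ) : ℝ :=
  ∑ l : Fin N, (wsq Q (x l.castSucc) + wsq R (u l)) + wsq S (x (Fin.last N))

/-- `(x, u)` is a global minimizer of the `N`-step problem from the current state `X`. -/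
def IsOptimal {ι κ : Type*} [Fintype ι] [Fintype κ] {N : ℕ} (F : Matrix ι ι ℝ)
    (E : Matrix ι κ ℝ) (Q : Matrix ι ι ℝ) (R : Matrix κ κ ℝ) (S : Matrix ι ι ℝ)
    (𝒰 : Set (κ → ℝ)) (𝒪 : Set (ι → ℝ)) (X : ι → ℝ)
    (x : Fin (N + 1) → ι → ℝ) (u : Fin N → κ → ℝ) : Prop :=
  IsFeasible F E 𝒰 𝒪 X x u ∧
  ∀ (x' : Fin (N + 1) → ι → ℝ) (u' : Fin N → κ → ℝ),
    IsFeasible F E 𝒰 𝒪 X x' u' → cost Q R S x u ≤ cost Q R S x' u'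

/-- `V` is the first input of some optimal solution of the `N`-step problem from `X`. -/
def IsRHCInput {ι κ : Type*} [Fintype ι] [Fintype κ] (N : ℕ) [NeZero N] (F : Matrix ι ι ℝ)
    (E : Matrix ι κ ℝ) (Q : Matrix ι ι ℝ) (R : Matrix κ κ ℝ) (S : Matrix ι ι ℝ)
    (𝒰 : Set (κ → ℝ)) (𝒪 : Set (ι → ℝ)) (X : ι → ℝ) (V : κ → ℝ) : Prop :=
  ∃ (x : Fin (N + 1) → ι → ℝ) (u : Fin N → κ → ℝ), IsOptimal F E Q R S 𝒰 𝒪 X x u ∧ V = u 0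

/-- Closed loop under a receding-horizon law. The law prescribes the input only at states from
which the problem is feasible: feasibility at later times is not part of this definition. -/
structure IsRHCClosedLoop {ι κ : Type*} [Fintype ι] [Fintype κ] (N : ℕ) [NeZero N]
    (F : Matrix ι ι ℝ) (E : Matrix ι κ ℝ) (Q : Matrix ι ι ℝ) (R : Matrix κ κ ℝ)
    (S : Matrix ι ι ℝ) (𝒰 : Set (κ → ℝ)) (𝒪 : Set (ι → ℝ))
    (X : ℕ → ι → ℝ) (U : ℕ → κ → ℝ) : Prop where
  dynamics : ∀ k, X (k + 1) = F *ᵥ X k + E *ᵥ U k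
  law : ∀ k, (∃ (x : Fin (N + 1) → ι → ℝ) (u : Fin N → κ → ℝ), IsFeasible F E 𝒰 𝒪 (X k) x u) →
    IsRHCInput N F E Q R S 𝒰 𝒪 (X k) (U k)

/-! ### Consensus -/

/-- State of agent `i`, as a Euclidean vector. -/
def agent {M n : ℕ} (X : Fin M × Fin n → ℝ) (i : Fin M) : EuclideanSpace ℝ (Fin n) :=
  WithLp.toLp 2 fun a => X (i, a)

/-- `‖xⁱ_k - xʲ_k‖ → 0` for all agents `i`, `j`. -/
def ReachesConsensus {M n : ℕ} (X : ℕ → Fin M × Fin n → ℝ) : Prop :=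
  ∀ i j, Tendsto (fun k => ‖agent (X k) i - agent (X k) j‖) atTop (𝓝 0)

/-- Consensus, and for each agent `lim ‖xⁱ_k‖` exists and is finite. -/
def ReachesConvergentConsensus {M n : ℕ} (X : ℕ → Fin M × Fin n → ℝ) : Prop :=
  ReachesConsensus X ∧ ∀ i, ∃ r : ℝ, Tendsto (fun k => ‖agent (X k) i‖) atTop (𝓝 r)

end RHCConsensus

end

open RHCConsensus

namespace RHCConsensus

/-! ### Weighted squares -/

/-! Since `W` is positive definite and `W L` symmetric, `L` is self-adjoint for the inner product of
`W` and has a `W`-orthonormal eigenbasis (`exists_modal_basis`). In that basis the dynamics and all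
three weights decouple into modes `y' = A y + B v`, one for each eigenvalue `μ`. Writing `G = Bᵀ S₂
B` and `g = gain A B S₂ *ᵥ y`, the weights are `μ |C₂ y|² + c μ² / (1 + α) |g|_G²` on the state, `(1
- c μ) / c |v|_G²` on the input and `μ |y|_{S₂}²` at the end. For a Laplacian `μ ≥ 0`, and a
spanning tree makes the eigenvectors for `μ = 0` constant: those modes carry the consensus motion,
the others the disagreement. Only the input constraints couple the modes.

Completing the square with the Lyapunov equation shows that `K*` lowers the terminal weight by at
least the stage cost (`wsq_matKstar_decrease`). The usual shift argument then gives recursive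
feasibility and a decreasing optimal cost, so the state cost tends to `0`. For a disagreement mode
this means `C₂ y → 0` and `g → 0`, hence `y → 0` (`tendsto_zero_of_output`).

A consensus mode has no state weight, and the coupled constraints may make the optimizer drive it.
This stops after finitely many steps: near consensus the optimal cost is at most the terminal
weight, so it tends to `0`, and so do the disagreement parts of all predicted inputs. As `0` is
interior to the input sets, deleting the consensus part of the predicted inputs is eventually
admissible. It leaves the state costs unchanged and lowers the input cost unless that part is
already zero (`mode_eq_zero_of_isOptimal`). From then on consensus modes follow `y' = A y`, whose
trajectories converge (`exists_tendsto_free_response`). -/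

theorem transpose_eq_of_posDef {ι : Type*} {P : Matrix ι ι ℝ} (hP : P.PosDef) : Pᵀ = P := by
  simpa using hP.isHermitian.eq

theorem continuous_mulVec {ι κ : Type*} [Fintype κ] (T : Matrix ι κ ℝ) :
    Continuous fun x : κ → ℝ => T *ᵥ x :=
  Continuous.matrix_mulVec continuous_const continuous_id

theorem tendsto_mulVec {ι κ : Type*} [Fintype κ] {l : Filter ℕ} (T : Matrix ι κ ℝ)
    {f : ℕ → κ → ℝ} {x : κ → ℝ}
    (hf : Tendsto f l (𝓝 x)) : Tendsto (fun k => T *ᵥ f k) l (𝓝 (T *ᵥ x)) :=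
  ((continuous_mulVec T).tendsto x).comp hf

theorem tendsto_mulVec_zero {ι κ : Type*} [Fintype κ] {l : Filter ℕ} (T : Matrix ι κ ℝ)
    {f : ℕ → κ → ℝ} (hf : Tendsto f l (𝓝 0)) : Tendsto (fun k => T *ᵥ f k) l (𝓝 0) := by
  simpa using tendsto_mulVec T hf

/-- A linear map between finite-dimensional spaces that is injective reflects convergence to `0`. -/
theorem tendsto_zero_of_injective {ι V : Type*} [Finite ι] [AddCommGroup V] [Module ℝ V]
    [TopologicalSpace V] [IsTopologicalAddGroup V] [ContinuousSMul ℝ V] [T2Space V] [FiniteDimensional ℝ V]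
    {l : Filter ℕ} (φ : (ι → ℝ) →ₗ[ℝ] V) (hφ : ∀ x, φ x = 0 → x = 0) {f : ℕ → ι → ℝ}
    (hf : Tendsto (fun k => φ (f k)) l (𝓝 0)) : Tendsto f l (𝓝 0) := by
  obtain ⟨g, hg⟩ := φ.exists_leftInverse_of_injective (LinearMap.ker_eq_bot'.mpr hφ)
  have h := (g.continuous_of_finiteDimensional.tendsto 0).comp hf
  rw [map_zero] at h
  refine h.congr fun k => ?_
  exact congrArg (fun ψ : (ι → ℝ) →ₗ[ℝ] (ι → ℝ) => ψ (f k)) hg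

section WeightedSquare

variable {ι κ : Type*} [Fintype ι] [Fintype κ]

theorem wsq_zero (P : Matrix ι ι ℝ) : wsq P 0 = 0 := by simp [wsq]

theorem wsq_nonneg {P : Matrix ι ι ℝ} (hP : P.PosSemidef) (x : ι → ℝ) : 0 ≤ wsq P x := by
  simpa [wsq] using hP.dotProduct_mulVec_nonneg x

theorem wsq_pos {P : Matrix ι ι ℝ} (hP : P.PosDef) {x : ι → ℝ} (hx : x ≠ 0) : 0 < wsq P x := by
  simpa [wsq] using hP.dotProduct_mulVec_pos hx

theorem wsq_eq_zero_iff {P : Matrix ι ι ℝ} (hP : P.PosDef) {x : ι → ℝ} : wsq P x = 0 ↔ x = 0 := by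
  constructor
  · intro h
    by_contra hx
    exact (wsq_pos hP hx).ne' h
  · rintro rfl
    exact wsq_zero P

theorem dotProduct_mulVec_comm_of_symm {P : Matrix ι ι ℝ} (hP : Pᵀ = P) (x y : ι → ℝ) :
    x ⬝ᵥ (P *ᵥ y) = y ⬝ᵥ (P *ᵥ x) := by
  rw [Matrix.dotProduct_mulVec, ← Matrix.mulVec_transpose, hP, dotProduct_comm]

theorem wsq_add {P : Matrix ι ι ℝ} (hP : Pᵀ = P) (x y : ι → ℝ) :
    wsq P (x + y) = wsq P x + 2 * (x ⬝ᵥ (P *ᵥ y)) + wsq P y := by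
  simp only [wsq, Matrix.mulVec_add, dotProduct_add, add_dotProduct]
  rw [dotProduct_mulVec_comm_of_symm hP y x]
  ring

theorem wsq_smul (P : Matrix ι ι ℝ) (t : ℝ) (x : ι → ℝ) : wsq P (t • x) = t ^ 2 * wsq P x := by
  simp only [wsq, Matrix.mulVec_smul, dotProduct_smul, smul_dotProduct, smul_eq_mul]
  ring

theorem wsq_smul_left (P : Matrix ι ι ℝ) (t : ℝ) (x : ι → ℝ) : wsq (t • P) x = t * wsq P x := by
  simp [wsq, Matrix.smul_mulVec]

theorem wsq_add_left (P Q : Matrix ι ι ℝ) (x : ι → ℝ) : wsq (P + Q) x = wsq P x + wsq Q x := by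
  simp [wsq, Matrix.add_mulVec]

theorem wsq_mulVec (P : Matrix ι ι ℝ) (T : Matrix ι κ ℝ) (x : κ → ℝ) :
    wsq P (T *ᵥ x) = wsq (Tᵀ * P * T) x := by
  simp only [wsq, ← Matrix.mulVec_mulVec]
  rw [Matrix.dotProduct_mulVec x, Matrix.vecMul_transpose]

theorem wsq_transpose_mul_self (T : Matrix ι κ ℝ) (x : κ → ℝ) :
    wsq (Tᵀ * T) x = (T *ᵥ x) ⬝ᵥ (T *ᵥ x) := by
  simp only [wsq, ← Matrix.mulVec_mulVec]
  rw [Matrix.dotProduct_mulVec x, Matrix.vecMul_transpose]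

theorem wsq_diagonal_kronecker [DecidableEq ι] (d : ι → ℝ) (K : Matrix κ κ ℝ) (Y : ι × κ → ℝ) :
    wsq (Matrix.diagonal d ⊗ₖ K) Y = ∑ j, d j * wsq K (fun a => Y (j, a)) := by
  simp only [wsq, Matrix.mulVec, dotProduct, Fintype.sum_prod_type, Finset.mul_sum,
    Matrix.kroneckerMap_apply, Matrix.diagonal_apply, ite_mul, zero_mul]
  refine Finset.sum_congr rfl fun j _ => Finset.sum_congr rfl fun a _ => ?_
  rw [Finset.sum_eq_single j]
  · refine Finset.sum_congr rfl fun b _ => ?_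
    simp only [if_true]
    ring
  · intro i _ hij
    simp [hij.symm]
  · simp

theorem continuous_wsq (P : Matrix ι ι ℝ) : Continuous (wsq P) := by
  unfold wsq
  exact Continuous.dotProduct continuous_id (continuous_mulVec P)

theorem tendsto_wsq_zero {l : Filter ℕ} (P : Matrix ι ι ℝ) {f : ℕ → ι → ℝ}
    (hf : Tendsto f l (𝓝 0)) : Tendsto (fun k => wsq P (f k)) l (𝓝 0) := by
  have := ((continuous_wsq P).tendsto 0).comp hf
  rwa [wsq_zero] at this

theorem tendsto_zero_of_dotProduct_self {l : Filter ℕ} {f : ℕ → ι → ℝ}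
    (hf : Tendsto (fun k => f k ⬝ᵥ f k) l (𝓝 0)) : Tendsto f l (𝓝 0) := by
  rw [tendsto_pi_nhds]
  intro i
  have h : Tendsto (fun k => √(f k ⬝ᵥ f k)) l (𝓝 0) := by
    have := (Real.continuous_sqrt.tendsto 0).comp hf
    rwa [Real.sqrt_zero] at this
  refine squeeze_zero_norm (fun k => ?_) h
  rw [Real.norm_eq_abs]
  apply Real.abs_le_sqrt
  rw [sq]
  exact Finset.single_le_sum (f := fun i => f k i * f k i) (fun j _ => mul_self_nonneg _)
    (Finset.mem_univ i)

open scoped MatrixOrder Matrix.Norms.L2Operator in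
theorem exists_eq_transpose_mul_self [DecidableEq ι] {P : Matrix ι ι ℝ} (hP : P.PosDef) :
    ∃ T : Matrix ι ι ℝ, IsUnit T.det ∧ P = Tᵀ * T := by
  obtain ⟨T, hT⟩ := CStarAlgebra.nonneg_iff_eq_star_mul_self.mp hP.posSemidef.nonneg
  have hT' : P = Tᵀ * T := by
    rw [hT, Matrix.star_eq_conjTranspose, Matrix.conjTranspose_eq_transpose_of_trivial]
  refine ⟨T, ?_, hT'⟩
  have h : IsUnit P.det := (Matrix.isUnit_iff_isUnit_det P).mp hP.isUnit
  rw [hT', Matrix.det_mul] at h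
  exact isUnit_of_mul_isUnit_right h

theorem tendsto_zero_of_wsq {l : Filter ℕ} {P : Matrix ι ι ℝ} (hP : P.PosDef) {f : ℕ → ι → ℝ}
    (hf : Tendsto (fun k => wsq P (f k)) l (𝓝 0)) : Tendsto f l (𝓝 0) := by
  classical
  obtain ⟨T, hT, rfl⟩ := exists_eq_transpose_mul_self hP
  simp only [wsq_transpose_mul_self] at hf
  have h := tendsto_mulVec_zero T⁻¹ (tendsto_zero_of_dotProduct_self hf)
  simpa [Matrix.mulVec_mulVec, Matrix.nonsing_inv_mul _ hT] using h

end WeightedSquare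

/-! ### Simultaneous diagonalization -/

/-- If `W` is positive definite and `W L` is symmetric, then `L` has a `W`-orthonormal basis of
eigenvectors. -/
theorem exists_modal_basis {ι : Type*} [Fintype ι] [DecidableEq ι] {W L : Matrix ι ι ℝ}
    (hW : W.PosDef) (hWL : (W * L).IsSymm) :
    ∃ (P T : Matrix ι ι ℝ) (ev : ι → ℝ), T * P = 1 ∧ P * T = 1 ∧ Pᵀ * W * P = 1 ∧
      L * P = P * Matrix.diagonal ev := by
  obtain ⟨R, hR, rfl⟩ := exists_eq_transpose_mul_self hW
  have hRi := Matrix.nonsing_inv_mul _ hR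
  have hRi' := Matrix.mul_nonsing_inv _ hR
  -- With `W = Rᵀ R`, self-adjointness of `L` for `W` is ordinary symmetry of its conjugate by `R`;
  -- the orthonormal eigenbasis of the conjugate is pulled back by `R⁻¹`.
  have hsym : (R * L * R⁻¹).IsHermitian := by
    have h1 : Lᵀ * Rᵀ * R = Rᵀ * R * L := by
      have := hWL.eq
      simpa [Matrix.transpose_mul, Matrix.mul_assoc] using this
    rw [Matrix.IsHermitian, Matrix.conjTranspose_eq_transpose_of_trivial, Matrix.transpose_mul,
      Matrix.transpose_mul, Matrix.transpose_nonsing_inv]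
    have hRt := Matrix.nonsing_inv_mul Rᵀ (by rwa [Matrix.det_transpose])
    calc Rᵀ⁻¹ * (Lᵀ * Rᵀ) = Rᵀ⁻¹ * (Lᵀ * Rᵀ * R) * R⁻¹ := by
          simp only [Matrix.mul_assoc, hRi', Matrix.mul_one]
      _ = (Rᵀ⁻¹ * Rᵀ) * (R * L) * R⁻¹ := by rw [h1]; simp only [Matrix.mul_assoc]
      _ = R * L * R⁻¹ := by rw [hRt, Matrix.one_mul]
  set V : Matrix ι ι ℝ := (hsym.eigenvectorUnitary : Matrix ι ι ℝ) with hV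
  have hVV : Vᵀ * V = 1 := by
    have := Unitary.coe_star_mul_self hsym.eigenvectorUnitary
    simpa [Matrix.star_eq_conjTranspose] using this
  have hVV' : V * Vᵀ = 1 := by
    have := Unitary.coe_mul_star_self hsym.eigenvectorUnitary
    simpa [Matrix.star_eq_conjTranspose] using this
  have hspec : R * L * R⁻¹ = V * Matrix.diagonal hsym.eigenvalues * Vᵀ := by
    have := hsym.spectral_theorem
    rw [Unitary.conjStarAlgAut_apply] at this
    simpa [Matrix.star_eq_conjTranspose, Function.comp_def] using this
  refine ⟨R⁻¹ * V, Vᵀ * R, hsym.eigenvalues, ?_, ?_, ?_, ?_⟩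
  · calc Vᵀ * R * (R⁻¹ * V) = Vᵀ * (R * R⁻¹) * V := by simp only [Matrix.mul_assoc]
      _ = 1 := by rw [hRi', Matrix.mul_one, hVV]
  · calc R⁻¹ * V * (Vᵀ * R) = R⁻¹ * (V * Vᵀ) * R := by simp only [Matrix.mul_assoc]
      _ = 1 := by rw [hVV', Matrix.mul_one, hRi]
  · calc (R⁻¹ * V)ᵀ * (Rᵀ * R) * (R⁻¹ * V) = (R * (R⁻¹ * V))ᵀ * (R * (R⁻¹ * V)) := by
          simp only [Matrix.transpose_mul, Matrix.mul_assoc]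
      _ = 1 := by rw [← Matrix.mul_assoc R, hRi', Matrix.one_mul, hVV]
  · calc L * (R⁻¹ * V) = R⁻¹ * (R * L * R⁻¹) * V := by
          simp only [← Matrix.mul_assoc, hRi, Matrix.one_mul]
      _ = R⁻¹ * V * Matrix.diagonal hsym.eigenvalues := by
          rw [congrArg (R⁻¹ * · * V) hspec]
          simp only [Matrix.mul_assoc, hVV, Matrix.mul_one]

/-! ### Spectrum of the graph Laplacian -/

section Laplacian

variable {M : ℕ} (G : Digraph (Fin M))

theorem laplacian_mulVec (v : Fin M → ℝ) (i : Fin M) :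
    (laplacian G *ᵥ v) i = ∑ j, adjMat G i j * (v i - v j) := by
  simp only [laplacian, Matrix.sub_mulVec, Pi.sub_apply, Matrix.mulVec_diagonal, mul_sub,
    Finset.sum_sub_distrib, Finset.sum_mul]
  rfl

theorem adjMat_nonneg (i j : Fin M) : 0 ≤ adjMat G i j := by
  simp only [adjMat, Matrix.of_apply]
  split_ifs <;> norm_num

theorem adjMat_eq_one {i j : Fin M} (h : G.Adj j i) : adjMat G i j = 1 := by
  simp [adjMat, h]

variable {G}

/-- Maximum principle: where `v` is maximal, `L v` is a sum of nonnegative terms, yet it equals `μ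
v` with `μ < 0`, so the maximum is at most `0`. -/
theorem nonpos_of_laplacian_eigenvector {v : Fin M → ℝ} {μ : ℝ} (hμ : μ < 0)
    (hv : laplacian G *ᵥ v = μ • v) (i : Fin M) : v i ≤ 0 := by
  obtain ⟨k, -, hk⟩ := Finset.exists_max_image Finset.univ v ⟨i, Finset.mem_univ i⟩
  refine (hk i (Finset.mem_univ i)).trans ?_
  have h1 : 0 ≤ (laplacian G *ᵥ v) k := by
    rw [laplacian_mulVec]
    exact Finset.sum_nonneg fun j _ => mul_nonneg (adjMat_nonneg G k j)
      (sub_nonneg.mpr (hk j (Finset.mem_univ j)))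
  rw [hv, Pi.smul_apply, smul_eq_mul] at h1
  by_contra h
  push Not at h
  nlinarith

theorem laplacian_eigenvalue_nonneg {v : Fin M → ℝ} {μ : ℝ} (hv0 : v ≠ 0)
    (hv : laplacian G *ᵥ v = μ • v) : 0 ≤ μ := by
  by_contra! hμ
  apply hv0
  funext i
  have h1 := nonpos_of_laplacian_eigenvector hμ hv i
  have h2 := nonpos_of_laplacian_eigenvector (v := -v) hμ
    (by rw [Matrix.mulVec_neg, hv, smul_neg]) i
  simp only [Pi.neg_apply, Pi.zero_apply] at *
  linarith

/-- At a maximum of `v` the vanishing row of `L v` is a sum of nonnegative terms, so every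
in-neighbour attains the maximum too. Following a path backwards, the maximum reaches the root. -/
theorem le_root_of_laplacian_mulVec_eq_zero {v : Fin M → ℝ} (hv : laplacian G *ᵥ v = 0)
    {r : Fin M} (hr : ∀ i, Relation.ReflTransGen G.Adj r i) (i : Fin M) : v i ≤ v r := by
  obtain ⟨k, -, hk⟩ := Finset.exists_max_image Finset.univ v ⟨i, Finset.mem_univ i⟩
  refine (hk i (Finset.mem_univ i)).trans (le_of_eq ?_)
  refine Relation.ReflTransGen.head_induction_on (motive := fun a _ => v k = v a) (hr k) rfl ?_
  intro a b hab _ hb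
  have h1 := congrFun hv b
  rw [laplacian_mulVec, Pi.zero_apply, Finset.sum_eq_zero_iff_of_nonneg] at h1
  · have h2 := h1 a (Finset.mem_univ a)
    rw [adjMat_eq_one G hab] at h2
    linarith
  · intro j _
    exact mul_nonneg (adjMat_nonneg G b j)
      (sub_nonneg.mpr (hb ▸ hk j (Finset.mem_univ j)))

/-- With a spanning tree, the kernel of the Laplacian consists of the constant vectors. -/
theorem eq_of_laplacian_mulVec_eq_zero (hG : HasSpanningTree G) {v : Fin M → ℝ}
    (hv : laplacian G *ᵥ v = 0) (i j : Fin M) : v i = v j := by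
  obtain ⟨r, hr⟩ := hG
  have key : ∀ i, v i = v r := fun i => by
    have h1 := le_root_of_laplacian_mulVec_eq_zero hv hr i
    have h2 := le_root_of_laplacian_mulVec_eq_zero (v := -v)
      (by rw [Matrix.mulVec_neg, hv, neg_zero]) hr i
    simp only [Pi.neg_apply] at h2
    linarith
  rw [key i, key j]

end Laplacian

/-! ### Modal coordinates -/

section Modes

variable {ι κ κ' : Type*} [Fintype ι] [Fintype κ] [DecidableEq κ] [Fintype κ'] [DecidableEq κ']

/-- The `j`-th block of `(T ⊗ I) X`. -/
def mode (T : Matrix ι ι ℝ) (X : ι × κ → ℝ) (j : ι) : κ → ℝ :=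
  fun a => ((T ⊗ₖ (1 : Matrix κ κ ℝ)) *ᵥ X) (j, a)

theorem mode_apply (T : Matrix ι ι ℝ) (X : ι × κ → ℝ) (j : ι) (a : κ) :
    mode T X j a = ∑ i, T j i * X (i, a) := by
  simp [mode, Matrix.mulVec, dotProduct, Fintype.sum_prod_type, Matrix.one_apply]

theorem mode_mode (T T' : Matrix ι ι ℝ) (X : ι × κ → ℝ) :
    mode T (fun q => mode T' X q.1 q.2) = mode (T * T') X := by
  funext j a
  simp only [mode]
  rw [Matrix.mulVec_mulVec, ← Matrix.mul_kronecker_mul, Matrix.one_mul]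

theorem mode_one [DecidableEq ι] (X : ι × κ → ℝ) (j : ι) : mode (1 : Matrix ι ι ℝ) X j = fun a => X (j, a) := by
  funext a
  simp [mode]

theorem mode_add (T : Matrix ι ι ℝ) (X Y : ι × κ → ℝ) (j : ι) :
    mode T (X + Y) j = mode T X j + mode T Y j := by
  funext a
  simp [mode, Matrix.mulVec_add]

/-- The rows of `T` are left eigenvectors of `Z`, so `Z ⊗ K` acts on each block separately. `K` may
be rectangular, as input matrices and gains require. -/
theorem mode_kronecker_diagonal [DecidableEq ι] (T Z : Matrix ι ι ℝ) (d : ι → ℝ) (h : T * Z = Matrix.diagonal d * T)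
    (K : Matrix κ' κ ℝ) (X : ι × κ → ℝ) (j : ι) :
    mode T ((Z ⊗ₖ K) *ᵥ X) j = d j • (K *ᵥ mode T X j) := by
  funext a
  simp only [mode]
  rw [Matrix.mulVec_mulVec, ← Matrix.mul_kronecker_mul, h, Matrix.one_mul]
  have : (Matrix.diagonal d * T) ⊗ₖ K = (Matrix.diagonal d ⊗ₖ K) * (T ⊗ₖ (1 : Matrix κ κ ℝ)) := by
    rw [← Matrix.mul_kronecker_mul, Matrix.mul_one]
  rw [this, ← Matrix.mulVec_mulVec]
  change ((Matrix.diagonal d ⊗ₖ K) *ᵥ fun q => mode T X q.1 q.2) (j, a) = _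
  simp [Matrix.mulVec, dotProduct, Fintype.sum_prod_type, Matrix.diagonal_apply, Finset.mul_sum,
    mul_assoc]

theorem mode_one_kronecker [DecidableEq ι] (T : Matrix ι ι ℝ) (K : Matrix κ' κ ℝ) (X : ι × κ → ℝ) (j : ι) :
    mode T (((1 : Matrix ι ι ℝ) ⊗ₖ K) *ᵥ X) j = K *ᵥ mode T X j := by
  rw [mode_kronecker_diagonal T 1 1 (by simp)]
  simp

theorem wsq_kronecker [DecidableEq ι] {P T Z : Matrix ι ι ℝ} {d : ι → ℝ} (hPT : P * T = 1)
    (h : Pᵀ * Z * P = Matrix.diagonal d) (K : Matrix κ κ ℝ) (X : ι × κ → ℝ) :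
    wsq (Z ⊗ₖ K) X = ∑ j, d j * wsq K (mode T X j) := by
  have hX : X = (P ⊗ₖ (1 : Matrix κ κ ℝ)) *ᵥ ((T ⊗ₖ (1 : Matrix κ κ ℝ)) *ᵥ X) := by
    rw [Matrix.mulVec_mulVec, ← Matrix.mul_kronecker_mul, hPT, Matrix.one_mul]
    simp
  conv_lhs => rw [hX]
  rw [wsq_mulVec, ← Matrix.kroneckerMap_transpose, ← Matrix.mul_kronecker_mul,
    ← Matrix.mul_kronecker_mul, h, Matrix.transpose_one, Matrix.one_mul, Matrix.mul_one,
    wsq_diagonal_kronecker]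
  rfl

end Modes

/-! ### Dynamics of a single mode -/

theorem eq_zero_of_rank_of_mulVec_eq_zero {ι : Type*} [Finite ι] {m : ℕ}
    {T : Matrix ι (Fin m) ℝ} (hT : T.rank = m) {x : Fin m → ℝ} (hx : T *ᵥ x = 0) : x = 0 := by
  have h := T.mulVecLin.finrank_range_add_finrank_ker
  have hT' : Module.finrank ℝ (LinearMap.range T.mulVecLin) = m := hT
  rw [hT', Module.finrank_fintype_fun_eq_card, Fintype.card_fin, Nat.add_eq_left,
    Submodule.finrank_eq_zero, LinearMap.ker_eq_bot'] at h
  exact h x (by simpa using hx)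

theorem exists_span_ker_of_rank {p n : ℕ} {C : Matrix (Fin p) (Fin n) ℝ} (hC : C.rank + 1 = n) :
    ∃ w : Fin n → ℝ, w ≠ 0 ∧ C *ᵥ w = 0 ∧ ∀ y, C *ᵥ y = 0 → ∃ t : ℝ, y = t • w := by
  have h := C.mulVecLin.finrank_range_add_finrank_ker
  have hC' : Module.finrank ℝ (LinearMap.range C.mulVecLin) = C.rank := rfl
  rw [hC', Module.finrank_fintype_fun_eq_card, Fintype.card_fin] at h
  have h1 : Module.finrank ℝ (LinearMap.ker C.mulVecLin) = 1 := by omega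
  obtain ⟨w, hw0, hw⟩ := finrank_eq_one_iff'.mp h1
  refine ⟨w, fun h0 => hw0 (Subtype.ext h0), LinearMap.mem_ker.mp w.2, fun y hy => ?_⟩
  obtain ⟨t, ht⟩ := hw ⟨y, by simpa using hy⟩
  exact ⟨t, (congrArg Subtype.val ht).symm⟩

variable {n m p : ℕ} {A : Matrix (Fin n) (Fin n) ℝ} {B : Matrix (Fin n) (Fin m) ℝ}
  {C : Matrix (Fin p) (Fin n) ℝ} {S : Matrix (Fin n) (Fin n) ℝ}

/-- The Hautus test at eigenvalue `1`: `zᵀ Aⁱ B = zᵀ B = 0` for all `i`, so `z` annihilates the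
Kalman matrix, which has full row rank. -/
theorem eq_zero_of_left_eigenvector (hctrl : IsControllable A B) {z : Fin n → ℝ}
    (hA : Aᵀ *ᵥ z = z) (hB : Bᵀ *ᵥ z = 0) : z = 0 := by
  have hpow : ∀ i : ℕ, (A ^ i)ᵀ *ᵥ z = z := by
    intro i
    induction i with
    | zero => simp
    | succ i ih => rw [pow_succ, Matrix.transpose_mul, ← Matrix.mulVec_mulVec, ih, hA]
  have h : (Matrix.of fun (a : Fin n) (q : Fin n × Fin m) => (A ^ (q.1 : ℕ) * B) a q.2)ᵀ.rank
      = n := by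
    rw [Matrix.rank_transpose]
    exact hctrl
  refine eq_zero_of_rank_of_mulVec_eq_zero h ?_
  funext q
  have h1 : (A ^ (q.1 : ℕ) * B)ᵀ *ᵥ z = 0 := by
    rw [Matrix.transpose_mul, ← Matrix.mulVec_mulVec, hpow, hB]
  exact congrFun h1 q.2

theorem posDef_transpose_mul_mul (hB : B.rank = m) (hS : S.PosDef) : (Bᵀ * S * B).PosDef := by
  rw [← Matrix.conjTranspose_eq_transpose_of_trivial]
  refine hS.conjTranspose_mul_mul_same fun x y hxy => ?_
  rw [← sub_eq_zero]
  exact eq_zero_of_rank_of_mulVec_eq_zero hB (by rw [Matrix.mulVec_sub, sub_eq_zero]; exact hxy)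

/-- The gain `(Bᵀ S B)⁻¹ Bᵀ S A`. -/
noncomputable def gain (A : Matrix (Fin n) (Fin n) ℝ) (B : Matrix (Fin n) (Fin m) ℝ)
    (S : Matrix (Fin n) (Fin n) ℝ) : Matrix (Fin m) (Fin n) ℝ :=
  (Bᵀ * S * B)⁻¹ * (Bᵀ * S * A)

theorem mul_gain (hG : (Bᵀ * S * B).PosDef) : Bᵀ * S * B * gain A B S = Bᵀ * S * A := by
  rw [gain, Matrix.mul_nonsing_inv_cancel_left _ _
    ((Matrix.isUnit_iff_isUnit_det _).mp hG.isUnit)]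

theorem matK2_eq (hG : (Bᵀ * S * B).PosDef) {α : ℝ} (hα : 0 < α) :
    matK2 A B S α = -((1 + α)⁻¹ • gain A B S) := by
  have h : Bᵀ * S * B + matR2 B S α = (1 + α) • (Bᵀ * S * B) := by
    rw [matR2, add_smul, one_smul]
  have hα' : (1 + α) ≠ 0 := by positivity
  have hinv : ((1 + α) • (Bᵀ * S * B))⁻¹ = (1 + α)⁻¹ • (Bᵀ * S * B)⁻¹ := by
    refine Matrix.inv_eq_right_inv ?_
    rw [Matrix.smul_mul, Matrix.mul_smul, smul_smul, mul_inv_cancel₀ hα', one_smul,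
      Matrix.mul_nonsing_inv _ ((Matrix.isUnit_iff_isUnit_det _).mp hG.isUnit)]
  rw [matK2, h, hinv, gain]
  simp only [Matrix.smul_mul, Matrix.mul_assoc]

theorem matH_eq (hG : (Bᵀ * S * B).PosDef) (hS : Sᵀ = S) :
    matH A B S = (gain A B S)ᵀ * (Bᵀ * S * B) * gain A B S := by
  rw [Matrix.mul_assoc, mul_gain hG, gain, matH, Matrix.transpose_mul, Matrix.transpose_nonsing_inv,
    transpose_eq_of_posDef hG]
  simp only [Matrix.transpose_mul, Matrix.transpose_transpose, hS, Matrix.mul_assoc]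

theorem wsq_matH (hG : (Bᵀ * S * B).PosDef) (hS : Sᵀ = S) (y : Fin n → ℝ) :
    wsq (matH A B S) y = wsq (Bᵀ * S * B) (gain A B S *ᵥ y) := by
  rw [matH_eq hG hS, wsq_mulVec]

theorem wsq_lyapunov (hL : Aᵀ * S * A - S = -(Cᵀ * C)) (y : Fin n → ℝ) :
    wsq S (A *ᵥ y) = wsq S y - wsq (Cᵀ * C) y := by
  rw [wsq_mulVec, show Aᵀ * S * A = S + (-1 : ℝ) • (Cᵀ * C) by
    rw [neg_one_smul, ← hL]; abel, wsq_add_left, wsq_smul_left]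
  ring

/-- Completion of the square in the one-step change of the Lyapunov function. -/
theorem wsq_step (hG : (Bᵀ * S * B).PosDef) (hS : Sᵀ = S) (hL : Aᵀ * S * A - S = -(Cᵀ * C))
    (y : Fin n → ℝ) (v : Fin m → ℝ) :
    wsq S (A *ᵥ y + B *ᵥ v) = wsq S y - wsq (Cᵀ * C) y
      + wsq (Bᵀ * S * B) (v + gain A B S *ᵥ y) - wsq (Bᵀ * S * B) (gain A B S *ᵥ y) := by
  rw [wsq_add hS, wsq_lyapunov hL, wsq_mulVec S B, wsq_add (transpose_eq_of_posDef hG),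
    Matrix.mulVec_mulVec, Matrix.mulVec_mulVec, mul_gain hG]
  have h : (A *ᵥ y) ⬝ᵥ ((S * B) *ᵥ v) = v ⬝ᵥ ((Bᵀ * S * A) *ᵥ y) := by
    rw [Matrix.dotProduct_mulVec, dotProduct_comm, ← Matrix.mulVec_transpose,
      Matrix.mulVec_mulVec, Matrix.transpose_mul, hS]
  rw [h]
  ring

/-! ### The output kernel and convergence of one mode -/

/-- The Lyapunov equation applied to `w` reads `Aᵀ S A w = S w`. It turns a fixed vector in the
output kernel into a left eigenvector. -/
theorem transpose_mulVec_eq_of_kernel (hL : Aᵀ * S * A - S = -(Cᵀ * C)) {w : Fin n → ℝ}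
    (hCw : C *ᵥ w = 0) (hAw : A *ᵥ w = w) : Aᵀ *ᵥ (S *ᵥ w) = S *ᵥ w := by
  have h : (Aᵀ * S * A - S) *ᵥ w = 0 := by
    rw [hL, Matrix.neg_mulVec, ← Matrix.mulVec_mulVec, hCw]
    simp
  rwa [Matrix.sub_mulVec, sub_eq_zero, ← Matrix.mulVec_mulVec, hAw, ← Matrix.mulVec_mulVec] at h

/-- As `ker C` is a line, either `A w` leaves it or `A w = t w`. In the latter case `C (A - 1)ⁱ w =
(t - 1)ⁱ C w = 0` for all `i`, and semi-observability forces `t = 1`. The normalization makes `w ⬝ᵥ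
(S *ᵥ y)` the coordinate of `y` along `w`. -/
theorem exists_kernel_direction (hobs : IsSemiObservable C A) (hC : C.rank + 1 = n)
    (hS : S.PosDef) :
    ∃ w : Fin n → ℝ, wsq S w = 1 ∧ C *ᵥ w = 0 ∧ (∀ y, C *ᵥ y = 0 → ∃ t : ℝ, y = t • w) ∧
      (A *ᵥ w = w ∨ C *ᵥ (A *ᵥ w) ≠ 0) := by
  obtain ⟨w, hw0, hCw, hw⟩ := exists_span_ker_of_rank hC
  have hpos := wsq_pos hS hw0
  set s := √(wsq S w) with hs
  have hs0 : s ≠ 0 := (Real.sqrt_pos.mpr hpos).ne'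
  refine ⟨s⁻¹ • w, ?_, ?_, ?_, ?_⟩
  · rw [wsq_smul, inv_pow, hs, Real.sq_sqrt hpos.le, inv_mul_cancel₀ hpos.ne']
  · rw [Matrix.mulVec_smul, hCw, smul_zero]
  · intro y hy
    obtain ⟨t, rfl⟩ := hw y hy
    exact ⟨t * s, by rw [smul_smul, mul_assoc, mul_inv_cancel₀ hs0, mul_one]⟩
  · rw [or_iff_not_imp_right, not_not]
    intro h
    rw [Matrix.mulVec_smul, Matrix.mulVec_smul, smul_eq_zero_iff_right (inv_ne_zero hs0)] at h
    obtain ⟨t, ht⟩ := hw _ h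
    have h1 : ∀ i : ℕ, (A - 1) ^ i *ᵥ w = (t - 1) ^ i • w := by
      intro i
      induction i with
      | zero => simp
      | succ i ih =>
        rw [pow_succ, ← Matrix.mulVec_mulVec, Matrix.sub_mulVec, ht, Matrix.one_mulVec, pow_succ',
          ← smul_smul, ← ih, ← Matrix.mulVec_smul, sub_smul, one_smul]
    have h2 : (A - 1) *ᵥ w = 0 := (hobs w).mpr fun i => by
      rw [← Matrix.mulVec_mulVec, h1, Matrix.mulVec_smul, hCw, smul_zero]
    rw [Matrix.sub_mulVec, Matrix.one_mulVec, sub_eq_zero] at h2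
    rw [Matrix.mulVec_smul, h2]

/-- Vectors with vanishing output approach the output kernel. -/
theorem tendsto_sub_kernel_component {w : Fin n → ℝ} (hw1 : wsq S w = 1) (hCw : C *ᵥ w = 0)
    (hw : ∀ y, C *ᵥ y = 0 → ∃ t : ℝ, y = t • w) {y : ℕ → Fin n → ℝ}
    (hy : Tendsto (fun k => C *ᵥ y k) atTop (𝓝 0)) :
    Tendsto (fun k => y k - (w ⬝ᵥ (S *ᵥ y k)) • w) atTop (𝓝 0) := by
  -- Output together with the coordinate along `w` determines a vector; the remainder has coordinate
  -- `0` and the same output as `y k`.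
  let φ : (Fin n → ℝ) →ₗ[ℝ] (Fin p → ℝ) × ℝ :=
    C.mulVecLin.prod ((dotProductBilin ℝ ℝ w).comp S.mulVecLin)
  have hφ : ∀ x, φ x = (C *ᵥ x, w ⬝ᵥ (S *ᵥ x)) := fun x => rfl
  refine tendsto_zero_of_injective φ ?_ ?_
  · intro x hx
    rw [hφ, Prod.mk_eq_zero] at hx
    obtain ⟨t, rfl⟩ := hw x hx.1
    have h : t * wsq S w = 0 := by simpa [Matrix.mulVec_smul, wsq] using hx.2
    rw [hw1, mul_one] at h
    rw [h, zero_smul]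
  · have h : ∀ k, φ (y k - (w ⬝ᵥ (S *ᵥ y k)) • w) = (C *ᵥ y k, 0) := by
      intro k
      have hw1' : w ⬝ᵥ (S *ᵥ w) = 1 := hw1
      rw [hφ, Matrix.mulVec_sub, Matrix.mulVec_smul, hCw, Matrix.mulVec_sub, Matrix.mulVec_smul,
        dotProduct_sub, dotProduct_smul, hw1']
      simp
    simp only [h]
    exact hy.prodMk_nhds tendsto_const_nhds

/-- The recursion contracts backwards in time: `a k` is estimated from `j` steps in the future. No
later value is known, so the uniform bound `K` starts the estimate. -/
theorem tendsto_zero_of_contraction {a ε : ℕ → ℝ} {s K : ℝ} (hs : |s| < 1)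
    (hK : ∀ k, |a k| ≤ K) (ha : ∀ k, a k = s * a (k + 1) + ε k)
    (hε : Tendsto ε atTop (𝓝 0)) : Tendsto a atTop (𝓝 0) := by
  rw [Metric.tendsto_atTop]
  intro δ hδ
  have h1s : 0 < 1 - |s| := by linarith
  rw [Metric.tendsto_atTop] at hε
  -- This tolerance makes `δ / 2` a fixed point of `t ↦ |s| t + δ / 2 * (1 - |s|)`.
  obtain ⟨k₀, hk₀⟩ := hε (δ / 2 * (1 - |s|)) (by positivity)
  refine ⟨k₀, fun k hk => ?_⟩
  have key : ∀ j k, k₀ ≤ k → |a k| ≤ |s| ^ j * K + δ / 2 := by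
    intro j
    induction j with
    | zero => intro k _; have := hK k; rw [pow_zero, one_mul]; linarith
    | succ j ih =>
      intro k hk
      have h1 := ih (k + 1) (by omega)
      have h2 := hk₀ k hk
      rw [Real.dist_eq, sub_zero] at h2
      calc |a k| ≤ |s| * |a (k + 1)| + |ε k| := by
            rw [ha k, ← abs_mul]; exact abs_add_le _ _
        _ ≤ |s| * (|s| ^ j * K + δ / 2) + δ / 2 * (1 - |s|) := by gcongr
        _ = |s| ^ (j + 1) * K + δ / 2 := by ring
  have hlim : Tendsto (fun j : ℕ => |s| ^ j * K + δ / 2) atTop (𝓝 (0 * K + δ / 2)) :=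
    ((tendsto_pow_atTop_nhds_zero_of_lt_one (abs_nonneg s) hs).mul_const K).add_const _
  have := ge_of_tendsto' hlim fun j => key j k hk
  rw [Real.dist_eq, sub_zero]
  linarith

/-- Strict Cauchy–Schwarz for `S`: `w` and `A w` both have norm `1`, the latter because `C w = 0` in
the Lyapunov equation, and they are not parallel because `A w` leaves `ker C`. -/
theorem abs_lt_one_of_not_kernel (hS : S.PosDef) (hL : Aᵀ * S * A - S = -(Cᵀ * C))
    {w : Fin n → ℝ} (hw1 : wsq S w = 1) (hCw : C *ᵥ w = 0) (hCAw : C *ᵥ (A *ᵥ w) ≠ 0) :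
    |(A *ᵥ w) ⬝ᵥ (S *ᵥ w)| < 1 := by
  set s := (A *ᵥ w) ⬝ᵥ (S *ᵥ w) with hs
  have h1 : wsq S (A *ᵥ w) = 1 := by
    rw [wsq_lyapunov hL, hw1, wsq_transpose_mul_self, hCw]; simp
  have h2 : A *ᵥ w + (-s) • w ≠ 0 := by
    intro h
    apply hCAw
    rw [eq_neg_of_add_eq_zero_left h, Matrix.mulVec_neg, Matrix.mulVec_smul, hCw]; simp
  have h3 := wsq_pos hS h2
  rw [wsq_add (transpose_eq_of_posDef hS), wsq_smul, h1, hw1, Matrix.mulVec_smul, dotProduct_smul,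
    ← hs, smul_eq_mul] at h3
  rw [← sq_lt_one_iff_abs_lt_one]
  linarith

/-- A mode with bounded input converges to `0` if both `C y` and `Bᵀ S A y` do. -/
theorem tendsto_zero_of_output (hctrl : IsControllable A B) (hobs : IsSemiObservable C A)
    (hC : C.rank + 1 = n) (hS : S.PosDef) (hL : Aᵀ * S * A - S = -(Cᵀ * C))
    {y : ℕ → Fin n → ℝ} {v : ℕ → Fin m → ℝ} (hyv : ∀ k, y (k + 1) = A *ᵥ y k + B *ᵥ v k)
    {b : ℝ} (hv : ∀ k, ‖v k‖ ≤ b) (hCy : Tendsto (fun k => C *ᵥ y k) atTop (𝓝 0))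
    (hDy : Tendsto (fun k => (Bᵀ * S * A) *ᵥ y k) atTop (𝓝 0)) :
    Tendsto y atTop (𝓝 0) := by
  have hSt := transpose_eq_of_posDef hS
  obtain ⟨w, hw1, hCw, hw, hAw⟩ := exists_kernel_direction hobs hC hS
  set a : ℕ → ℝ := fun k => w ⬝ᵥ (S *ᵥ y k) with ha
  have he := tendsto_sub_kernel_component hw1 hCw hw hCy
  suffices h : Tendsto a atTop (𝓝 0) by
    have h1 := he.add (h.smul_const w)
    simpa [ha] using h1
  by_cases hDw : (Bᵀ * S * A) *ᵥ w = 0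
  · rcases hAw with hAw | hCAw
    -- Here `S w` would be a left eigenvector of `A` annihilated by `Bᵀ`, contradicting
    -- controllability.
    · exfalso
      rw [← Matrix.mulVec_mulVec, hAw, ← Matrix.mulVec_mulVec] at hDw
      have h1 := transpose_mulVec_eq_of_kernel hL hCw hAw
      have h3 := eq_zero_of_left_eigenvector hctrl h1 hDw
      rw [wsq, h3] at hw1
      simp at hw1
    · have hAw1 : wsq S (A *ᵥ w) = 1 := by
        rw [wsq_lyapunov hL, hw1, wsq_transpose_mul_self, hCw]; simp
      set e : ℕ → Fin n → ℝ := fun k => y k - a k • w with hedef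
      have hye : ∀ k, y k = a k • w + e k := fun k => by simp [hedef]
      have he1 : Tendsto (fun k => e (k + 1)) atTop (𝓝 0) := (tendsto_add_atTop_iff_nat 1).mpr he
      -- In `C y (k + 1) = a k • C A w + C A e k + C B v k` every other term is bounded, the last
      -- one by the input bound, and `C A w ≠ 0`.
      obtain ⟨K, hK⟩ : ∃ K, ∀ k, |a k| ≤ K := by
        obtain ⟨i, hi⟩ := Function.ne_iff.mp hCAw
        rw [Pi.zero_apply] at hi
        have hr : Tendsto (fun k => C *ᵥ y (k + 1) - C *ᵥ (A *ᵥ e k)) atTop (𝓝 0) := by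
          simpa using ((tendsto_add_atTop_iff_nat 1).mpr hCy).sub
            (tendsto_mulVec_zero C (tendsto_mulVec_zero A he))
        obtain ⟨K₁, hK₁⟩ := hr.norm.bddAbove_range
        set T := (C * B).mulVecLin.toContinuousLinearMap with hT
        refine ⟨(K₁ + ‖T‖ * b) / |(C *ᵥ (A *ᵥ w)) i|, fun k => ?_⟩
        rw [le_div_iff₀ (abs_pos.mpr hi), ← abs_mul]
        have h1 : a k • (C *ᵥ (A *ᵥ w))
            = (C *ᵥ y (k + 1) - C *ᵥ (A *ᵥ e k)) - T (v k) := by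
          have h2 : T (v k) = C *ᵥ (B *ᵥ v k) := (Matrix.mulVec_mulVec (v k) C B).symm
          rw [h2, hyv, hye k]
          simp only [Matrix.mulVec_add, Matrix.mulVec_smul]
          abel
        calc |a k * (C *ᵥ (A *ᵥ w)) i| = ‖(a k • (C *ᵥ (A *ᵥ w))) i‖ := rfl
          _ ≤ ‖a k • (C *ᵥ (A *ᵥ w))‖ := norm_le_pi_norm _ i
          _ ≤ ‖C *ᵥ y (k + 1) - C *ᵥ (A *ᵥ e k)‖ + ‖T (v k)‖ := by
            rw [h1]; exact norm_sub_le _ _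
          _ ≤ K₁ + ‖T‖ * b := add_le_add (hK₁ ⟨k, rfl⟩)
            ((T.le_opNorm _).trans (mul_le_mul_of_nonneg_left (hv k) (norm_nonneg _)))
      -- Pairing `e (k + 1) - A e k` with `S A w` removes the input, since `Bᵀ S A w = 0`, and
      -- leaves `a k - s * a (k + 1)`.
      refine tendsto_zero_of_contraction
        (ε := fun k => (A *ᵥ w) ⬝ᵥ (S *ᵥ (e (k + 1) - A *ᵥ e k)))
        (abs_lt_one_of_not_kernel hS hL hw1 hCw hCAw) hK (fun k => ?_) ?_
      · have h1 : (A *ᵥ w) ⬝ᵥ (S *ᵥ (B *ᵥ v k)) = 0 := by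
          rw [Matrix.mulVec_mulVec, Matrix.dotProduct_mulVec, ← Matrix.mulVec_transpose,
            Matrix.mulVec_mulVec, Matrix.transpose_mul, hSt, hDw, zero_dotProduct]
        have h2 : e (k + 1) - A *ᵥ e k = a k • (A *ᵥ w) + B *ᵥ v k - a (k + 1) • w := by
          simp only [hedef]
          rw [hyv, Matrix.mulVec_sub, Matrix.mulVec_smul]
          abel
        have h3 : (A *ᵥ w) ⬝ᵥ (S *ᵥ (A *ᵥ w)) = 1 := hAw1
        rw [h2, Matrix.mulVec_sub, Matrix.mulVec_add, Matrix.mulVec_smul, Matrix.mulVec_smul,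
          dotProduct_sub, dotProduct_add, dotProduct_smul, dotProduct_smul, h1, h3]
        simp only [smul_eq_mul]
        ring
      · have h1 : Tendsto (fun k => S *ᵥ (e (k + 1) - A *ᵥ e k)) atTop (𝓝 0) :=
          tendsto_mulVec_zero S (by simpa using he1.sub (tendsto_mulVec_zero A he))
        have h2 : Continuous fun x : Fin n → ℝ => (A *ᵥ w) ⬝ᵥ x :=
          Continuous.dotProduct continuous_const continuous_id
        simpa [Function.comp_def] using (h2.tendsto 0).comp h1
  · obtain ⟨i, hi⟩ := Function.ne_iff.mp hDw
    rw [Pi.zero_apply] at hi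
    have h1 := hDy.sub (tendsto_mulVec_zero (Bᵀ * S * A) he)
    have h2 := (tendsto_pi_nhds.mp h1 i).mul_const (((Bᵀ * S * A) *ᵥ w) i)⁻¹
    simp only [Matrix.mulVec_sub, Matrix.mulVec_smul, sub_sub_cancel, Pi.smul_apply, smul_eq_mul,
      mul_assoc, mul_inv_cancel₀ hi] at h2
    simpa using h2

/-- The free response of a mode converges. -/
theorem exists_tendsto_free_response (hobs : IsSemiObservable C A)
    (hC : C.rank + 1 = n) (hS : S.PosDef) (hL : Aᵀ * S * A - S = -(Cᵀ * C))
    {y : ℕ → Fin n → ℝ} (hy : ∀ k, y (k + 1) = A *ᵥ y k) :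
    ∃ z, Tendsto y atTop (𝓝 z) := by
  have hSt := transpose_eq_of_posDef hS
  obtain ⟨w, hw1, hCw, hw, hAw⟩ := exists_kernel_direction hobs hC hS
  have hstep : ∀ k, wsq S (y (k + 1)) = wsq S (y k) - wsq (Cᵀ * C) (y k) := fun k => by
    rw [hy, wsq_lyapunov hL]
  have hnn : ∀ k, 0 ≤ wsq (Cᵀ * C) (y k) := fun k => by
    rw [wsq_transpose_mul_self]
    exact Finset.sum_nonneg fun i _ => mul_self_nonneg _
  have hanti : Antitone fun k => wsq S (y k) := antitone_nat_of_succ_le fun k => by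
    have := hstep k
    have := hnn k
    linarith
  have hconv := tendsto_atTop_ciInf hanti
    ⟨0, by rintro _ ⟨k, rfl⟩; exact wsq_nonneg hS.posSemidef _⟩
  have hCy : Tendsto (fun k => C *ᵥ y k) atTop (𝓝 0) := by
    apply tendsto_zero_of_dotProduct_self
    have h1 := hconv.sub ((tendsto_add_atTop_iff_nat 1).mpr hconv)
    rw [sub_self] at h1
    refine h1.congr fun k => ?_
    rw [hstep, wsq_transpose_mul_self]
    ring
  have he := tendsto_sub_kernel_component hw1 hCw hw hCy
  suffices h : ∃ r, Tendsto (fun k => w ⬝ᵥ (S *ᵥ y k)) atTop (𝓝 r) by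
    obtain ⟨r, hr⟩ := h
    have h1 := he.add (hr.smul_const w)
    simp only [sub_add_cancel] at h1
    exact ⟨_, h1⟩
  rcases hAw with hAw | hCAw
  -- When `A w = w`, also `Aᵀ S w = S w`, so the coordinate along `w` is conserved.
  · refine ⟨w ⬝ᵥ (S *ᵥ y 0), tendsto_const_nhds.congr fun k => ?_⟩
    have h1 := transpose_mulVec_eq_of_kernel hL hCw hAw
    induction k with
    | zero => rfl
    | succ k ih =>
      rw [ih, hy, dotProduct_mulVec_comm_of_symm hSt w, dotProduct_mulVec_comm_of_symm hSt w,
        dotProduct_comm (A *ᵥ y k), Matrix.dotProduct_mulVec _ A, ← Matrix.mulVec_transpose, h1,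
        dotProduct_comm]
  -- Otherwise a component along `w` shows up in the next output, which tends to `0`; so that
  -- component vanishes in the limit.
  · obtain ⟨i, hi⟩ := Function.ne_iff.mp hCAw
    rw [Pi.zero_apply] at hi
    have h1 := ((tendsto_add_atTop_iff_nat 1).mpr hCy).sub
      (tendsto_mulVec_zero C (tendsto_mulVec_zero A he))
    have h2 := (tendsto_pi_nhds.mp h1 i).mul_const ((C *ᵥ (A *ᵥ w)) i)⁻¹
    simp only [hy, Matrix.mulVec_sub, Matrix.mulVec_smul, sub_sub_cancel, Pi.smul_apply,
      smul_eq_mul, mul_assoc, mul_inv_cancel₀ hi] at h2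
    exact ⟨0, by simpa using h2⟩

/-! ### Receding-horizon control with a terminal controller -/

section RecedingHorizon

variable {ι κ : Type*} [Fintype ι] [Fintype κ]

/-- `K` is an admissible terminal feedback: it respects the input constraints on `𝒪`, leaves `𝒪`
invariant, and the terminal weight decreases along it by at least the stage cost. -/
structure IsTerminalController (F : Matrix ι ι ℝ) (E : Matrix ι κ ℝ) (Q : Matrix ι ι ℝ)
    (R : Matrix κ κ ℝ) (S : Matrix ι ι ℝ) (𝒰 : Set (κ → ℝ)) (𝒪 : Set (ι → ℝ))
    (K : Matrix κ ι ℝ) : Prop where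
  input : ∀ X ∈ 𝒪, K *ᵥ X ∈ 𝒰
  invariant : ∀ X ∈ 𝒪, F *ᵥ X + E *ᵥ (K *ᵥ X) ∈ 𝒪
  decrease : ∀ X, wsq S (F *ᵥ X + E *ᵥ (K *ᵥ X)) + wsq Q X + wsq R (K *ᵥ X) ≤ wsq S X

variable {F : Matrix ι ι ℝ} {E : Matrix ι κ ℝ} {Q : Matrix ι ι ℝ} {R : Matrix κ κ ℝ}
  {S : Matrix ι ι ℝ} {𝒰 : Set (κ → ℝ)} {𝒪 : Set (ι → ℝ)} {K : Matrix κ ι ℝ}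

/-- Shifting a feasible solution by one step and appending the terminal feedback. -/
theorem IsFeasible.exists_shift {N : ℕ} [NeZero N] (hK : IsTerminalController F E Q R S 𝒰 𝒪 K)
    {X : ι → ℝ} {x : Fin (N + 1) → ι → ℝ} {u : Fin N → κ → ℝ} (h : IsFeasible F E 𝒰 𝒪 X x u) :
    ∃ (x' : Fin (N + 1) → ι → ℝ) (u' : Fin N → κ → ℝ),
      IsFeasible F E 𝒰 𝒪 (F *ᵥ X + E *ᵥ u 0) x' u' ∧
      cost Q R S x' u' + (wsq Q X + wsq R (u 0)) ≤ cost Q R S x u := by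
  obtain ⟨N, rfl⟩ : ∃ N', N = N' + 1 := Nat.exists_eq_succ_of_ne_zero (NeZero.ne N)
  set xN := x (Fin.last (N + 1)) with hxN
  refine ⟨Fin.snoc (fun l : Fin (N + 1) => x l.succ) (F *ᵥ xN + E *ᵥ (K *ᵥ xN)),
    Fin.snoc (fun l : Fin N => u l.succ) (K *ᵥ xN), ⟨?_, ?_, ?_, ?_⟩, ?_⟩
  · have h1 := h.dynamics 0
    rw [Fin.castSucc_zero, h.init] at h1
    rw [← h1]
    exact Fin.snoc_castSucc (α := fun _ => ι → ℝ) _ _ (0 : Fin (N + 1))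
  · intro l
    refine Fin.lastCases ?_ (fun l => ?_) l
    · rw [Fin.succ_last, Fin.snoc_last, Fin.snoc_last, Fin.snoc_castSucc, Fin.succ_last]
    · rw [Fin.succ_castSucc, Fin.snoc_castSucc, Fin.snoc_castSucc, Fin.snoc_castSucc,
        h.dynamics, Fin.succ_castSucc]
  · intro l
    refine Fin.lastCases ?_ (fun l => ?_) l
    · rw [Fin.snoc_last]
      exact hK.input _ h.terminal
    · rw [Fin.snoc_castSucc]
      exact h.input _
  · rw [Fin.snoc_last]
    exact hK.invariant _ h.terminal
  · have hdec := hK.decrease xN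
    unfold cost
    rw [Fin.sum_univ_castSucc]
    conv_rhs => rw [Fin.sum_univ_succ]
    simp only [Fin.snoc_last, Fin.snoc_castSucc, Fin.succ_last, Fin.castSucc_zero, h.init,
      Fin.succ_castSucc]
    linarith

/-- In the terminal set the optimal cost is at most the terminal weight. -/
theorem IsTerminalController.exists_feasible_cost_le
    (hK : IsTerminalController F E Q R S 𝒰 𝒪 K) (N : ℕ) {X : ι → ℝ} (hX : X ∈ 𝒪) :
    ∃ (x : Fin (N + 1) → ι → ℝ) (u : Fin N → κ → ℝ),
      IsFeasible F E 𝒰 𝒪 X x u ∧ cost Q R S x u ≤ wsq S X := by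
  set f : (ι → ℝ) → ι → ℝ := fun X => F *ᵥ X + E *ᵥ (K *ᵥ X) with hf
  have hmem : ∀ l : ℕ, f^[l] X ∈ 𝒪 := fun l => by
    induction l with
    | zero => exact hX
    | succ l ih => rw [Function.iterate_succ_apply']; exact hK.invariant _ ih
  refine ⟨fun l => f^[l] X, fun l => K *ᵥ (f^[l] X), ⟨rfl, fun l => ?_, fun l => ?_, hmem _⟩, ?_⟩
  · exact Function.iterate_succ_apply' f l X
  · exact hK.input _ (hmem _)
  · have key : ∀ N : ℕ, ∑ l ∈ Finset.range N, (wsq Q (f^[l] X) + wsq R (K *ᵥ (f^[l] X)))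
        + wsq S (f^[N] X) ≤ wsq S X := by
      intro N
      induction N with
      | zero => simp
      | succ N ih =>
        rw [Finset.sum_range_succ, Function.iterate_succ_apply']
        have := hK.decrease (f^[N] X)
        linarith
    have := key N
    rwa [Finset.sum_range] at this

/-- Recursive feasibility and convergence of the stage cost. -/
theorem IsRHCClosedLoop.exists_optimal {N : ℕ} [NeZero N]
    (hK : IsTerminalController F E Q R S 𝒰 𝒪 K)
    {X : ℕ → ι → ℝ} {U : ℕ → κ → ℝ} (h : IsRHCClosedLoop N F E Q R S 𝒰 𝒪 X U)
    (hinit : ∃ (x : Fin (N + 1) → ι → ℝ) (u : Fin N → κ → ℝ), IsFeasible F E 𝒰 𝒪 (X 0) x u) :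
    ∃ (x : ℕ → Fin (N + 1) → ι → ℝ) (u : ℕ → Fin N → κ → ℝ),
      ∀ k, IsOptimal F E Q R S 𝒰 𝒪 (X k) (x k) (u k) ∧ U k = u k 0 := by
  -- The law itself supplies an optimum wherever the problem is feasible, so only feasibility has to
  -- be propagated.
  have hfeas : ∀ k, ∃ (x : Fin (N + 1) → ι → ℝ) (u : Fin N → κ → ℝ),
      IsFeasible F E 𝒰 𝒪 (X k) x u := by
    intro k
    induction k with
    | zero => exact hinit
    | succ k ih =>
      obtain ⟨x, u, hopt, hu⟩ := h.law k ih
      obtain ⟨x', u', hf, -⟩ := hopt.1.exists_shift hK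
      refine ⟨x', u', ?_⟩
      rwa [h.dynamics, hu]
  choose x u hxu using fun k => h.law k (hfeas k)
  exact ⟨x, u, hxu⟩

/-- The optimal cost is a Lyapunov function: the shifted solution is a competitor at the next time
and is cheaper by at least the stage cost. The decrements of a decreasing nonnegative sequence tend
to `0`. -/
theorem IsRHCClosedLoop.tendsto_stage_cost {N : ℕ} [NeZero N]
    (hK : IsTerminalController F E Q R S 𝒰 𝒪 K)
    (hQ : ∀ X, 0 ≤ wsq Q X) (hR : ∀ U, 0 ≤ wsq R U) (hS : ∀ X, 0 ≤ wsq S X)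
    {X : ℕ → ι → ℝ} {U : ℕ → κ → ℝ} (h : IsRHCClosedLoop N F E Q R S 𝒰 𝒪 X U)
    {x : ℕ → Fin (N + 1) → ι → ℝ} {u : ℕ → Fin N → κ → ℝ}
    (hopt : ∀ k, IsOptimal F E Q R S 𝒰 𝒪 (X k) (x k) (u k) ∧ U k = u k 0) :
    Tendsto (fun k => wsq Q (X k)) atTop (𝓝 0) := by
  set J : ℕ → ℝ := fun k => cost Q R S (x k) (u k) with hJ
  have hJ0 : ∀ k, 0 ≤ J k := fun k =>
    add_nonneg (Finset.sum_nonneg fun l _ => add_nonneg (hQ _) (hR _)) (hS _)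
  have hstep : ∀ k, J (k + 1) + (wsq Q (X k) + wsq R (u k 0)) ≤ J k := fun k => by
    obtain ⟨x', u', hf, hc⟩ := (hopt k).1.1.exists_shift hK
    rw [← (hopt k).2, ← h.dynamics] at hf
    have := (hopt (k + 1)).1.2 x' u' hf
    linarith
  have hanti : Antitone J := antitone_nat_of_succ_le fun k => by
    have := hstep k
    have := hQ (X k)
    have := hR (u k 0)
    linarith
  have hconv := tendsto_atTop_ciInf hanti ⟨0, by rintro _ ⟨k, rfl⟩; exact hJ0 k⟩
  have hdiff := hconv.sub ((tendsto_add_atTop_iff_nat 1).mpr hconv)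
  rw [sub_self] at hdiff
  refine squeeze_zero (fun k => hQ _) (fun k => ?_) hdiff
  have := hstep k
  have := hR (u k 0)
  linarith

end RecedingHorizon

/-! ### The design conditions in modal coordinates -/

/-- `P` is a `W`-orthonormal basis of eigenvectors of `L` with eigenvalues `ev`; `T = P⁻¹`. -/
structure IsModalBasis {ι : Type*} [Fintype ι] [DecidableEq ι] (L W P T : Matrix ι ι ℝ)
    (ev : ι → ℝ) : Prop where
  left_inv : T * P = 1
  right_inv : P * T = 1
  orthonormal : Pᵀ * W * P = 1
  eigen : L * P = P * Matrix.diagonal ev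

namespace IsModalBasis

variable {ι : Type*} [Fintype ι] [DecidableEq ι] {L W P T : Matrix ι ι ℝ} {ev : ι → ℝ}

theorem mul_eq (hb : IsModalBasis L W P T ev) : T * L = Matrix.diagonal ev * T := by
  calc T * L = T * (L * P) * T := by
        simp only [Matrix.mul_assoc, hb.right_inv, Matrix.mul_one]
    _ = (T * P) * Matrix.diagonal ev * T := by rw [hb.eigen]; simp only [Matrix.mul_assoc]
    _ = Matrix.diagonal ev * T := by rw [hb.left_inv, Matrix.one_mul]

theorem congr_mul (hb : IsModalBasis L W P T ev) : Pᵀ * (W * L) * P = Matrix.diagonal ev := by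
  calc Pᵀ * (W * L) * P = Pᵀ * W * (L * P) := by simp only [Matrix.mul_assoc]
    _ = Pᵀ * W * P * Matrix.diagonal ev := by rw [hb.eigen]; simp only [Matrix.mul_assoc]
    _ = Matrix.diagonal ev := by rw [hb.orthonormal, Matrix.one_mul]

theorem congr_mul_mul (hb : IsModalBasis L W P T ev) :
    Pᵀ * (W * L * L) * P = Matrix.diagonal fun j => ev j * ev j := by
  calc Pᵀ * (W * L * L) * P = Pᵀ * (W * L) * (L * P) := by simp only [Matrix.mul_assoc]
    _ = Pᵀ * (W * L) * P * Matrix.diagonal ev := by rw [hb.eigen]; simp only [Matrix.mul_assoc]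
    _ = _ := by rw [hb.congr_mul, Matrix.diagonal_mul_diagonal]

theorem congr_one_sub (hb : IsModalBasis L W P T ev) (c : ℝ) :
    Pᵀ * (W * (1 - c • L)) * P = Matrix.diagonal fun j => 1 - c * ev j := by
  rw [Matrix.mul_sub, Matrix.mul_one, Matrix.mul_smul, Matrix.mul_sub, Matrix.sub_mul,
    Matrix.mul_smul, Matrix.smul_mul, hb.congr_mul, hb.orthonormal, ← Matrix.diagonal_one,
    ← Matrix.diagonal_smul, Matrix.diagonal_sub]
  rfl

theorem mulVec_col (hb : IsModalBasis L W P T ev) (j : ι) : L *ᵥ P.col j = ev j • P.col j := by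
  funext i
  have h := congrFun (congrFun hb.eigen i) j
  rw [Matrix.mul_diagonal] at h
  rw [Pi.smul_apply, smul_eq_mul, mul_comm]
  exact h

theorem col_ne_zero (hb : IsModalBasis L W P T ev) (j : ι) : P.col j ≠ 0 := by
  intro h
  have h1 := congrFun (congrFun hb.left_inv j) j
  rw [Matrix.mul_apply, Matrix.one_apply_eq] at h1
  have h2 : ∀ i, P i j = 0 := fun i => congrFun h i
  simp [h2] at h1

theorem mem_spectrum (hb : IsModalBasis L W P T ev) (j : ι) : ev j ∈ spectrum ℝ L := by
  rw [← Matrix.spectrum_toLin']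
  refine Module.End.HasEigenvalue.mem_spectrum
    (Module.End.hasEigenvalue_of_hasEigenvector (x := P.col j) ⟨?_, hb.col_ne_zero j⟩)
  rw [Module.End.mem_eigenspace_iff, Matrix.toLin'_apply]
  exact hb.mulVec_col j

theorem apply_eq_sum {κ : Type*} [Fintype κ] [DecidableEq κ] (hb : IsModalBasis L W P T ev)
    (X : ι × κ → ℝ) (i : ι) : (fun a => X (i, a)) = ∑ j, P i j • mode T X j := by
  rw [← mode_one X i, ← hb.right_inv, ← mode_mode]
  funext a
  rw [mode_apply, Finset.sum_apply]
  rfl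

end IsModalBasis

variable {M n m p : ℕ} {L W P T : Matrix (Fin M) (Fin M) ℝ} {ev : Fin M → ℝ}
  {A : Matrix (Fin n) (Fin n) ℝ} {B : Matrix (Fin n) (Fin m) ℝ} {C : Matrix (Fin p) (Fin n) ℝ}
  {S : Matrix (Fin n) (Fin n) ℝ} {c α : ℝ}

theorem DesignConditions.posDef_input (hd : DesignConditions L W A B C S c α) :
    (Bᵀ * S * B).PosDef :=
  posDef_transpose_mul_mul hd.fullColumnRank hd.posDef_S₂

theorem DesignConditions.symm_S₂ (hd : DesignConditions L W A B C S c α) : Sᵀ = S :=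
  transpose_eq_of_posDef hd.posDef_S₂

theorem DesignConditions.mul_eigenvalue_le_one (hd : DesignConditions L W A B C S c α)
    (hb : IsModalBasis L W P T ev) (hev : ∀ j, 0 ≤ ev j) (j : Fin M) : c * ev j ≤ 1 := by
  rcases (hev j).eq_or_lt with h | h
  · rw [← h, mul_zero]; exact zero_le_one
  · exact (le_div_iff₀ h).mp (hd.c_le _ (hb.mem_spectrum j) h.ne')

theorem wsq_matSs (hb : IsModalBasis L W P T ev) (X : Fin M × Fin n → ℝ) :
    wsq (matSs L W S) X = ∑ j, ev j * wsq S (mode T X j) :=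
  wsq_kronecker hb.right_inv hb.congr_mul S X

theorem wsq_matQs (hd : DesignConditions L W A B C S c α) (hb : IsModalBasis L W P T ev)
    (X : Fin M × Fin n → ℝ) :
    wsq (matQs L W A B C S c α) X = ∑ j, (ev j * wsq (Cᵀ * C) (mode T X j)
      + c / (1 + α) * (ev j * ev j) * wsq (Bᵀ * S * B) (gain A B S *ᵥ mode T X j)) := by
  rw [matQs, wsq_add_left, Matrix.smul_kronecker, wsq_smul_left, matS1,
    wsq_kronecker hb.right_inv hb.congr_mul, wsq_kronecker hb.right_inv hb.congr_mul_mul,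
    Finset.mul_sum, ← Finset.sum_add_distrib]
  simp only [wsq_matH hd.posDef_input hd.symm_S₂, mul_assoc]

/-- The factors `α` in `R₁` and `R₂` cancel. The resulting weight is `1 / c > 0` on consensus
inputs, but it vanishes on modes with `c * ev j = 1`. -/
theorem wsq_matRs (hd : DesignConditions L W A B C S c α) (hb : IsModalBasis L W P T ev)
    (U : Fin M × Fin m → ℝ) :
    wsq (matRs L W B S c α) U = ∑ j, (1 - c * ev j) / c * wsq (Bᵀ * S * B) (mode T U j) := by
  rw [matRs, matR1, matR2, Matrix.smul_kronecker, Matrix.kronecker_smul, wsq_smul_left,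
    wsq_smul_left, wsq_kronecker hb.right_inv (hb.congr_one_sub c), Finset.mul_sum, Finset.mul_sum]
  have := hd.c_pos.ne'
  have := hd.α_pos.ne'
  refine Finset.sum_congr rfl fun j _ => ?_
  field_simp

theorem mode_matKstar (hd : DesignConditions L W A B C S c α) (hb : IsModalBasis L W P T ev)
    (X : Fin M × Fin n → ℝ) (j : Fin M) :
    mode T (matKstar L A B S c α *ᵥ X) j
      = (-(c * ev j / (1 + α))) • (gain A B S *ᵥ mode T X j) := by
  have h : T * (c • L) = Matrix.diagonal (c • ev) * T := by
    rw [Matrix.mul_smul, hb.mul_eq, Matrix.diagonal_smul, Matrix.smul_mul]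
  rw [matKstar, mode_kronecker_diagonal T _ _ h, matK2_eq hd.posDef_input hd.α_pos,
    Matrix.neg_mulVec, Matrix.smul_mulVec, Pi.smul_apply, smul_eq_mul, smul_neg, smul_smul,
    neg_smul, div_eq_mul_inv]

theorem mode_dynamics (X : Fin M × Fin n → ℝ) (U : Fin M × Fin m → ℝ) (j : Fin M) :
    mode T (((1 : Matrix (Fin M) (Fin M) ℝ) ⊗ₖ A) *ᵥ X
      + ((1 : Matrix (Fin M) (Fin M) ℝ) ⊗ₖ B) *ᵥ U) j = A *ᵥ mode T X j + B *ᵥ mode T U j := by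
  rw [mode_add, mode_one_kronecker, mode_one_kronecker]

theorem wsq_output_nonneg (C : Matrix (Fin p) (Fin n) ℝ) (y : Fin n → ℝ) :
    0 ≤ wsq (Cᵀ * C) y := by
  rw [wsq_transpose_mul_self]
  exact Finset.sum_nonneg fun i _ => mul_self_nonneg _

theorem wsq_matSs_nonneg (hd : DesignConditions L W A B C S c α)
    (hb : IsModalBasis L W P T ev) (hev : ∀ j, 0 ≤ ev j) (X : Fin M × Fin n → ℝ) :
    0 ≤ wsq (matSs L W S) X := by
  rw [wsq_matSs hb]
  exact Finset.sum_nonneg fun j _ => mul_nonneg (hev j) (wsq_nonneg hd.posDef_S₂.posSemidef _)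

theorem modal_state_cost_nonneg (hd : DesignConditions L W A B C S c α) {μ : ℝ} (hμ : 0 ≤ μ)
    (y : Fin n → ℝ) :
    0 ≤ μ * wsq (Cᵀ * C) y + c / (1 + α) * (μ * μ) * wsq (Bᵀ * S * B) (gain A B S *ᵥ y) := by
  have h1 := wsq_output_nonneg C y
  have h2 := wsq_nonneg hd.posDef_input.posSemidef (gain A B S *ᵥ y)
  have := hd.c_pos
  have := hd.α_pos
  positivity

theorem wsq_matQs_nonneg (hd : DesignConditions L W A B C S c α)
    (hb : IsModalBasis L W P T ev) (hev : ∀ j, 0 ≤ ev j) (X : Fin M × Fin n → ℝ) :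
    0 ≤ wsq (matQs L W A B C S c α) X := by
  rw [wsq_matQs hd hb]
  exact Finset.sum_nonneg fun j _ => modal_state_cost_nonneg hd (hev j) _

theorem wsq_matRs_nonneg (hd : DesignConditions L W A B C S c α)
    (hb : IsModalBasis L W P T ev) (hev : ∀ j, 0 ≤ ev j) (U : Fin M × Fin m → ℝ) :
    0 ≤ wsq (matRs L W B S c α) U := by
  rw [wsq_matRs hd hb]
  exact Finset.sum_nonneg fun j _ => mul_nonneg
    (div_nonneg (sub_nonneg.mpr (hd.mul_eigenvalue_le_one hb hev j)) hd.c_pos.le)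
    (wsq_nonneg hd.posDef_input.posSemidef _)

theorem wsq_matKstar_decrease (hd : DesignConditions L W A B C S c α)
    (hb : IsModalBasis L W P T ev) (X : Fin M × Fin n → ℝ) :
    wsq (matSs L W S) (((1 : Matrix (Fin M) (Fin M) ℝ) ⊗ₖ A) *ᵥ X
        + ((1 : Matrix (Fin M) (Fin M) ℝ) ⊗ₖ B) *ᵥ (matKstar L A B S c α *ᵥ X))
      + wsq (matQs L W A B C S c α) X + wsq (matRs L W B S c α) (matKstar L A B S c α *ᵥ X)
      ≤ wsq (matSs L W S) X := by
  rw [wsq_matSs hb, wsq_matSs hb, wsq_matQs hd hb, wsq_matRs hd hb, ← Finset.sum_add_distrib,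
    ← Finset.sum_add_distrib]
  refine Finset.sum_le_sum fun j _ => ?_
  rw [mode_dynamics, mode_matKstar hd hb, wsq_step hd.posDef_input hd.symm_S₂ hd.lyapunov,
    wsq_smul]
  set g := gain A B S *ᵥ mode T X j
  set μ := ev j
  have h1 : (-(c * μ / (1 + α))) • g + g = (1 - c * μ / (1 + α)) • g := by
    rw [neg_smul, sub_smul, one_smul]; abel
  rw [h1, wsq_smul]
  set h := wsq (Bᵀ * S * B) g
  have hh : 0 ≤ h := wsq_nonneg hd.posDef_input.posSemidef g
  have hc := hd.c_pos
  have hα := hd.α_pos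
  -- The exact gap in the inequality for one mode; the output terms cancel and only multiples of `h`
  -- remain.
  have hslack : 0 ≤ c * μ ^ 2 * α / (1 + α) ^ 2 * h := by positivity
  have hid : μ * (wsq S (mode T X j) - wsq (Cᵀ * C) (mode T X j)
      + (1 - c * μ / (1 + α)) ^ 2 * h - h)
      + (μ * wsq (Cᵀ * C) (mode T X j) + c / (1 + α) * (μ * μ) * h)
      + (1 - c * μ) / c * ((-(c * μ / (1 + α))) ^ 2 * h)
      = μ * wsq S (mode T X j) - c * μ ^ 2 * α / (1 + α) ^ 2 * h := by
    field_simp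
    ring
  linarith

theorem isTerminalController_matKstar (hd : DesignConditions L W A B C S c α)
    (hb : IsModalBasis L W P T ev) (hev : ∀ j, 0 ≤ ev j) {𝒰 : Fin M → Set (Fin m → ℝ)} {β : ℝ}
    (hterminal : ∀ X ∈ levelSet (matSs L W S) β, matKstar L A B S c α *ᵥ X ∈ inputSet 𝒰) :
    IsTerminalController ((1 : Matrix (Fin M) (Fin M) ℝ) ⊗ₖ A) ((1 : Matrix (Fin M) (Fin M) ℝ) ⊗ₖ B)
      (matQs L W A B C S c α) (matRs L W B S c α) (matSs L W S) (inputSet 𝒰)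
      (levelSet (matSs L W S) β) (matKstar L A B S c α) where
  input := hterminal
  invariant X hX := by
    have h1 := wsq_matKstar_decrease hd hb X
    have h2 := wsq_matQs_nonneg hd hb hev X
    have h3 := wsq_matRs_nonneg hd hb hev (matKstar L A B S c α *ᵥ X)
    exact (Real.sqrt_le_sqrt (by linarith)).trans hX
  decrease := wsq_matKstar_decrease hd hb

/-! ### Vanishing costs and disagreement modes -/

theorem tendsto_modes_of_wsq_matQs (hd : DesignConditions L W A B C S c α)
    (hb : IsModalBasis L W P T ev) (hev : ∀ j, 0 ≤ ev j) {Z : ℕ → Fin M × Fin n → ℝ}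
    (hZ : Tendsto (fun k => wsq (matQs L W A B C S c α) (Z k)) atTop (𝓝 0)) {j : Fin M}
    (hj : 0 < ev j) :
    Tendsto (fun k => C *ᵥ mode T (Z k) j) atTop (𝓝 0) ∧
      Tendsto (fun k => gain A B S *ᵥ mode T (Z k) j) atTop (𝓝 0) := by
  have hc := hd.c_pos
  have hα := hd.α_pos
  have hle : ∀ k, ev j * wsq (Cᵀ * C) (mode T (Z k) j)
      + c / (1 + α) * (ev j * ev j) * wsq (Bᵀ * S * B) (gain A B S *ᵥ mode T (Z k) j)
      ≤ wsq (matQs L W A B C S c α) (Z k) := fun k => by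
    rw [wsq_matQs hd hb]
    exact Finset.single_le_sum (f := fun j => ev j * wsq (Cᵀ * C) (mode T (Z k) j)
      + c / (1 + α) * (ev j * ev j) * wsq (Bᵀ * S * B) (gain A B S *ᵥ mode T (Z k) j))
      (fun i _ => modal_state_cost_nonneg hd (hev i) _) (Finset.mem_univ j)
  have h1 : ∀ k, 0 ≤ wsq (Cᵀ * C) (mode T (Z k) j) := fun k => wsq_output_nonneg C _
  have h2 : ∀ k, 0 ≤ wsq (Bᵀ * S * B) (gain A B S *ᵥ mode T (Z k) j) := fun k =>
    wsq_nonneg hd.posDef_input.posSemidef _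
  have hcoef : 0 < c / (1 + α) * (ev j * ev j) := by positivity
  constructor
  · apply tendsto_zero_of_dotProduct_self
    have h3 := hZ.div_const (ev j)
    rw [zero_div] at h3
    refine squeeze_zero (fun k => ?_) (fun k => ?_) h3
    · rw [← wsq_transpose_mul_self]; exact h1 k
    · rw [← wsq_transpose_mul_self, le_div_iff₀ hj, mul_comm]
      have := mul_nonneg hcoef.le (h2 k)
      linarith [hle k]
  · apply tendsto_zero_of_wsq hd.posDef_input
    have h3 := hZ.div_const (c / (1 + α) * (ev j * ev j))
    rw [zero_div] at h3
    refine squeeze_zero h2 (fun k => ?_) h3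
    rw [le_div_iff₀ hcoef, mul_comm]
    have := mul_nonneg hj.le (h1 k)
    linarith [hle k]

theorem tendsto_mode_of_wsq_matSs (hd : DesignConditions L W A B C S c α)
    (hb : IsModalBasis L W P T ev) (hev : ∀ j, 0 ≤ ev j) {Z : ℕ → Fin M × Fin n → ℝ}
    (hZ : Tendsto (fun k => wsq (matSs L W S) (Z k)) atTop (𝓝 0)) {j : Fin M} (hj : 0 < ev j) :
    Tendsto (fun k => mode T (Z k) j) atTop (𝓝 0) := by
  have h0 : ∀ k i, 0 ≤ wsq S (mode T (Z k) i) := fun k i => wsq_nonneg hd.posDef_S₂.posSemidef _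
  apply tendsto_zero_of_wsq hd.posDef_S₂
  have h3 := hZ.div_const (ev j)
  rw [zero_div] at h3
  refine squeeze_zero (fun k => h0 k j) (fun k => ?_) h3
  rw [le_div_iff₀ hj, mul_comm, wsq_matSs hb]
  exact Finset.single_le_sum (f := fun j => ev j * wsq S (mode T (Z k) j))
    (fun i _ => mul_nonneg (hev i) (h0 k i)) (Finset.mem_univ j)

theorem tendsto_wsq_matSs (hb : IsModalBasis L W P T ev) (hev : ∀ j, 0 ≤ ev j)
    {Z : ℕ → Fin M × Fin n → ℝ}
    (hZ : ∀ j, 0 < ev j → Tendsto (fun k => mode T (Z k) j) atTop (𝓝 0)) :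
    Tendsto (fun k => wsq (matSs L W S) (Z k)) atTop (𝓝 0) := by
  simp only [wsq_matSs hb]
  rw [← Finset.sum_const_zero (s := (Finset.univ : Finset (Fin M)))]
  refine tendsto_finsetSum _ fun j _ => ?_
  rcases (hev j).eq_or_lt with h | h
  · simp [← h]
  · simpa using (tendsto_wsq_zero S (hZ j h)).const_mul (ev j)

/-- If the successor state, the output and the feedback term vanish in the limit, so do the state
and the input. -/
theorem tendsto_zero_of_successor (hd : DesignConditions L W A B C S c α)
    {y y' : ℕ → Fin n → ℝ} {v : ℕ → Fin m → ℝ} (hyv : ∀ k, y' k = A *ᵥ y k + B *ᵥ v k)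
    (hy' : Tendsto y' atTop (𝓝 0)) (hCy : Tendsto (fun k => C *ᵥ y k) atTop (𝓝 0))
    (hg : Tendsto (fun k => gain A B S *ᵥ y k) atTop (𝓝 0)) :
    Tendsto y atTop (𝓝 0) ∧ Tendsto v atTop (𝓝 0) := by
  have hG := hd.posDef_input
  have hsum : Tendsto (fun k => wsq S (y' k) + wsq (Cᵀ * C) (y k)
      + wsq (Bᵀ * S * B) (gain A B S *ᵥ y k)) atTop (𝓝 0) := by
    have h1 : Tendsto (fun k => wsq (Cᵀ * C) (y k)) atTop (𝓝 0) := by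
      have := tendsto_wsq_zero 1 hCy
      simp only [wsq_transpose_mul_self]
      simpa [wsq] using this
    simpa using ((tendsto_wsq_zero S hy').add h1).add (tendsto_wsq_zero _ hg)
  -- The input weight may be zero, so `v` cannot be read off the stage cost. The completed square,
  -- rearranged, has only nonnegative terms on both sides and controls `y` and `v + gain y` at once.
  have hstep : ∀ k, wsq S (y' k) + wsq (Cᵀ * C) (y k) + wsq (Bᵀ * S * B) (gain A B S *ᵥ y k)
      = wsq S (y k) + wsq (Bᵀ * S * B) (v k + gain A B S *ᵥ y k) := fun k => by
    rw [hyv, wsq_step hG hd.symm_S₂ hd.lyapunov]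
    ring
  simp only [hstep] at hsum
  have h1 : ∀ k, 0 ≤ wsq S (y k) := fun k => wsq_nonneg hd.posDef_S₂.posSemidef _
  have h2 : ∀ k, 0 ≤ wsq (Bᵀ * S * B) (v k + gain A B S *ᵥ y k) := fun k =>
    wsq_nonneg hG.posSemidef _
  constructor
  · exact tendsto_zero_of_wsq hd.posDef_S₂
      (squeeze_zero h1 (fun k => le_add_of_nonneg_right (h2 k)) hsum)
  · have h3 := tendsto_zero_of_wsq hG (squeeze_zero h2 (fun k => le_add_of_nonneg_left (h1 k)) hsum)
    simpa using h3.sub hg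

/-! ### Removing the consensus modes of a predicted input -/

section DisagreementProjection

variable {M n m p N : ℕ} {L W P T : Matrix (Fin M) (Fin M) ℝ} {ev : Fin M → ℝ}
  {A : Matrix (Fin n) (Fin n) ℝ} {B : Matrix (Fin n) (Fin m) ℝ} {C : Matrix (Fin p) (Fin n) ℝ}
  {S : Matrix (Fin n) (Fin n) ℝ} {c α : ℝ}

/-- The projection onto the eigenvectors with nonzero eigenvalue, along the other ones. -/
noncomputable def disagreementProj (P T : Matrix (Fin M) (Fin M) ℝ) (ev : Fin M → ℝ) :
    Matrix (Fin M) (Fin M) ℝ :=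
  P * Matrix.diagonal (fun j => if ev j = 0 then 0 else 1) * T

theorem mul_disagreementProj (hb : IsModalBasis L W P T ev) :
    T * disagreementProj P T ev = Matrix.diagonal (fun j => if ev j = 0 then 0 else 1) * T := by
  rw [disagreementProj, ← Matrix.mul_assoc, ← Matrix.mul_assoc, hb.left_inv, Matrix.one_mul]

theorem mode_disagreementProj {κ : Type*} [Fintype κ] [DecidableEq κ]
    (hb : IsModalBasis L W P T ev) (X : Fin M × κ → ℝ) (j : Fin M) :
    mode T ((disagreementProj P T ev ⊗ₖ (1 : Matrix κ κ ℝ)) *ᵥ X) j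
      = if ev j = 0 then 0 else mode T X j := by
  rw [mode_kronecker_diagonal T _ _ (mul_disagreementProj hb), Matrix.one_mulVec]
  split_ifs <;> simp

/-- The predicted states after the consensus modes of the inputs have been removed. -/
noncomputable def projectedState (P T : Matrix (Fin M) (Fin M) ℝ) (ev : Fin M → ℝ)
    (A : Matrix (Fin n) (Fin n) ℝ) (X : Fin M × Fin n → ℝ) (x : Fin (N + 1) → Fin M × Fin n → ℝ)
    (l : Fin (N + 1)) : Fin M × Fin n → ℝ :=
  (disagreementProj P T ev ⊗ₖ (1 : Matrix (Fin n) (Fin n) ℝ)) *ᵥ x l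
    + ((1 - disagreementProj P T ev) ⊗ₖ (A ^ (l : ℕ))) *ᵥ X

theorem mode_projectedState (hb : IsModalBasis L W P T ev) (X : Fin M × Fin n → ℝ)
    (x : Fin (N + 1) → Fin M × Fin n → ℝ) (l : Fin (N + 1)) {j : Fin M} (hj : ev j ≠ 0) :
    mode T (projectedState P T ev A X x l) j = mode T (x l) j := by
  have h : T * (1 - disagreementProj P T ev)
      = Matrix.diagonal (1 - fun j => if ev j = 0 then 0 else 1) * T := by
    rw [Matrix.mul_sub, mul_disagreementProj hb, Matrix.mul_one]
    funext i a
    simp only [Matrix.sub_apply, Matrix.diagonal_mul, Pi.sub_apply, Pi.one_apply]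
    ring
  rw [projectedState, mode_add, mode_disagreementProj hb, if_neg hj,
    mode_kronecker_diagonal T _ _ h]
  simp [hj]

theorem wsq_matSs_projectedState (hb : IsModalBasis L W P T ev) (X : Fin M × Fin n → ℝ)
    (x : Fin (N + 1) → Fin M × Fin n → ℝ) (l : Fin (N + 1)) :
    wsq (matSs L W S) (projectedState P T ev A X x l) = wsq (matSs L W S) (x l) := by
  rw [wsq_matSs hb, wsq_matSs hb]
  refine Finset.sum_congr rfl fun j _ => ?_
  by_cases hj : ev j = 0
  · rw [hj, zero_mul, zero_mul]
  · rw [mode_projectedState hb X x _ hj]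

theorem wsq_matQs_projectedState (hd : DesignConditions L W A B C S c α)
    (hb : IsModalBasis L W P T ev) (X : Fin M × Fin n → ℝ)
    (x : Fin (N + 1) → Fin M × Fin n → ℝ) (l : Fin (N + 1)) :
    wsq (matQs L W A B C S c α) (projectedState P T ev A X x l)
      = wsq (matQs L W A B C S c α) (x l) := by
  rw [wsq_matQs hd hb, wsq_matQs hd hb]
  refine Finset.sum_congr rfl fun j _ => ?_
  by_cases hj : ev j = 0
  · simp only [hj, zero_mul, mul_zero]
  · rw [mode_projectedState hb X x _ hj]

/-- The projection acts on agents and commutes with `I ⊗ A` and `I ⊗ B`, while the consensus part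
follows the free response `Aˡ`. The terminal set does not see consensus modes. -/
theorem isFeasible_projectedState (hb : IsModalBasis L W P T ev)
    {𝒰 : Set (Fin M × Fin m → ℝ)} {β : ℝ} {X : Fin M × Fin n → ℝ}
    {x : Fin (N + 1) → Fin M × Fin n → ℝ} {u : Fin N → Fin M × Fin m → ℝ}
    (h : IsFeasible ((1 : Matrix (Fin M) (Fin M) ℝ) ⊗ₖ A) ((1 : Matrix (Fin M) (Fin M) ℝ) ⊗ₖ B)
      𝒰 (levelSet (matSs L W S) β) X x u)
    (hu : ∀ l, (disagreementProj P T ev ⊗ₖ (1 : Matrix (Fin m) (Fin m) ℝ)) *ᵥ u l ∈ 𝒰) :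
    IsFeasible ((1 : Matrix (Fin M) (Fin M) ℝ) ⊗ₖ A) ((1 : Matrix (Fin M) (Fin M) ℝ) ⊗ₖ B)
      𝒰 (levelSet (matSs L W S) β) X (projectedState P T ev A X x)
      (fun l => (disagreementProj P T ev ⊗ₖ (1 : Matrix (Fin m) (Fin m) ℝ)) *ᵥ u l) where
  init := by
    rw [projectedState, h.init, Fin.val_zero, pow_zero, ← Matrix.add_mulVec,
      ← Matrix.add_kronecker, add_sub_cancel, Matrix.one_kronecker_one, Matrix.one_mulVec]
  dynamics l := by
    simp only [projectedState, h.dynamics, Matrix.mulVec_add, Matrix.mulVec_mulVec,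
      ← Matrix.mul_kronecker_mul, Matrix.one_mul, Matrix.mul_one, Fin.val_succ, Fin.val_castSucc,
      pow_succ']
    abel
  input := hu
  terminal := by
    have h2 := h.terminal
    simp only [levelSet, Set.mem_ofPred_eq] at h2 ⊢
    rwa [wsq_matSs_projectedState hb]

/-- If removing the consensus modes keeps the inputs of an optimal solution admissible, then the
first input has no consensus modes. -/
theorem mode_eq_zero_of_isOptimal [NeZero N] (hd : DesignConditions L W A B C S c α)
    (hb : IsModalBasis L W P T ev) (hev : ∀ j, 0 ≤ ev j)
    {𝒰 : Set (Fin M × Fin m → ℝ)} {β : ℝ} {X : Fin M × Fin n → ℝ}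
    {x : Fin (N + 1) → Fin M × Fin n → ℝ} {u : Fin N → Fin M × Fin m → ℝ}
    (h : IsOptimal ((1 : Matrix (Fin M) (Fin M) ℝ) ⊗ₖ A) ((1 : Matrix (Fin M) (Fin M) ℝ) ⊗ₖ B)
      (matQs L W A B C S c α) (matRs L W B S c α) (matSs L W S)
      𝒰 (levelSet (matSs L W S) β) X x u)
    (hu : ∀ l, (disagreementProj P T ev ⊗ₖ (1 : Matrix (Fin m) (Fin m) ℝ)) *ᵥ u l ∈ 𝒰)
    {j : Fin M} (hj : ev j = 0) : mode T (u 0) j = 0 := by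
  set D := disagreementProj P T ev ⊗ₖ (1 : Matrix (Fin m) (Fin m) ℝ) with hD
  have hc := hd.c_pos
  have hle := h.2 _ _ (isFeasible_projectedState hb h.1 hu)
  have hterm : ∀ l i, (1 - c * ev i) / c * wsq (Bᵀ * S * B) (mode T (D *ᵥ u l) i)
      ≤ (1 - c * ev i) / c * wsq (Bᵀ * S * B) (mode T (u l) i) := fun l i => by
    rw [hD, mode_disagreementProj hb]
    split_ifs
    · rw [wsq_zero, mul_zero]
      exact mul_nonneg (div_nonneg (sub_nonneg.mpr (hd.mul_eigenvalue_le_one hb hev i)) hc.le)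
        (wsq_nonneg hd.posDef_input.posSemidef _)
    · exact le_rfl
  have hR : ∀ l, wsq (matRs L W B S c α) (D *ᵥ u l) ≤ wsq (matRs L W B S c α) (u l) := fun l => by
    rw [wsq_matRs hd hb, wsq_matRs hd hb]
    exact Finset.sum_le_sum fun i _ => hterm l i
  simp only [cost, Finset.sum_add_distrib, wsq_matSs_projectedState hb,
    wsq_matQs_projectedState hd hb] at hle
  -- The state costs cancel, so optimality makes the input costs equal. Since projecting increases
  -- no summand, equality holds for each time and each mode; a consensus mode has coefficient `1 / c
  -- > 0`.
  have hsum : ∑ l, wsq (matRs L W B S c α) (D *ᵥ u l) = ∑ l, wsq (matRs L W B S c α) (u l) :=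
    le_antisymm (Finset.sum_le_sum fun l _ => hR l) (by linarith)
  have h0 := (Finset.sum_eq_sum_iff_of_le fun l _ => hR l).mp hsum 0 (Finset.mem_univ _)
  rw [wsq_matRs hd hb, wsq_matRs hd hb] at h0
  have h1 := (Finset.sum_eq_sum_iff_of_le fun i _ => hterm 0 i).mp h0 j (Finset.mem_univ _)
  rw [hD, mode_disagreementProj hb, if_pos hj, wsq_zero, mul_zero, hj, mul_zero, sub_zero, eq_comm,
    mul_eq_zero_iff_left (by positivity), wsq_eq_zero_iff hd.posDef_input] at h1
  exact h1

end DisagreementProjection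

/-! ### Input constraints -/

theorem exists_norm_mode_le {M m : ℕ} {𝒰 : Fin M → Set (Fin m → ℝ)}
    (hcompact : ∀ i, IsCompact (𝒰 i)) (T : Matrix (Fin M) (Fin M) ℝ) (j : Fin M) :
    ∃ b, ∀ U ∈ inputSet 𝒰, ‖mode T U j‖ ≤ b := by
  choose r hr using fun i => (hcompact i).isBounded.exists_norm_le
  refine ⟨∑ i, |T j i| * r i, fun U hU => ?_⟩
  have h1 : mode T U j = ∑ i, T j i • fun a => U (i, a) := by
    funext a
    rw [mode_apply, Finset.sum_apply]
    rfl
  rw [h1]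
  refine (norm_sum_le _ _).trans (Finset.sum_le_sum fun i _ => ?_)
  rw [norm_smul, Real.norm_eq_abs]
  exact mul_le_mul_of_nonneg_left (hr i _ (hU i)) (abs_nonneg _)

theorem eventually_mem_inputSet {M m : ℕ} {L W P T : Matrix (Fin M) (Fin M) ℝ} {ev : Fin M → ℝ}
    (hb : IsModalBasis L W P T ev) {𝒰 : Fin M → Set (Fin m → ℝ)}
    (hzero : ∀ i, (0 : Fin m → ℝ) ∈ interior (𝒰 i)) {V : ℕ → Fin M × Fin m → ℝ}
    (hV : ∀ j, Tendsto (fun k => mode T (V k) j) atTop (𝓝 0)) :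
    ∀ᶠ k in atTop, V k ∈ inputSet 𝒰 := by
  refine eventually_all.mpr fun i => ?_
  have h : Tendsto (fun k => fun a => V k (i, a)) atTop (𝓝 0) := by
    have h1 := tendsto_finsetSum Finset.univ fun j (_ : j ∈ Finset.univ) => (hV j).const_smul (P i j)
    simp only [smul_zero, Finset.sum_const_zero] at h1
    exact h1.congr fun k => (hb.apply_eq_sum (V k) i).symm
  exact h.eventually (mem_interior_iff_mem_nhds.mp (hzero i))

/-! ### Convergence of the closed loop -/

section ClosedLoop

variable {M n m p N : ℕ} {L W P T : Matrix (Fin M) (Fin M) ℝ} {ev : Fin M → ℝ}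
  {A : Matrix (Fin n) (Fin n) ℝ} {B : Matrix (Fin n) (Fin m) ℝ} {C : Matrix (Fin p) (Fin n) ℝ}
  {S : Matrix (Fin n) (Fin n) ℝ} {c α β : ℝ} {𝒰 : Fin M → Set (Fin m → ℝ)}
  {X : ℕ → Fin M × Fin n → ℝ} {U : ℕ → Fin M × Fin m → ℝ}
  {x : ℕ → Fin (N + 1) → Fin M × Fin n → ℝ} {u : ℕ → Fin N → Fin M × Fin m → ℝ}

theorem tendsto_disagreement_mode (hctrl : IsControllable A B)
    (hd : DesignConditions L W A B C S c α) (hb : IsModalBasis L W P T ev) (hev : ∀ j, 0 ≤ ev j)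
    (hcompact : ∀ i, IsCompact (𝒰 i)) (hU : ∀ k, U k ∈ inputSet 𝒰)
    (hdyn : ∀ k, X (k + 1) = ((1 : Matrix (Fin M) (Fin M) ℝ) ⊗ₖ A) *ᵥ X k
      + ((1 : Matrix (Fin M) (Fin M) ℝ) ⊗ₖ B) *ᵥ U k)
    (hstage : Tendsto (fun k => wsq (matQs L W A B C S c α) (X k)) atTop (𝓝 0)) {j : Fin M}
    (hj : 0 < ev j) : Tendsto (fun k => mode T (X k) j) atTop (𝓝 0) := by
  obtain ⟨hC, hg⟩ := tendsto_modes_of_wsq_matQs hd hb hev hstage hj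
  obtain ⟨b, hbd⟩ := exists_norm_mode_le hcompact T j
  refine tendsto_zero_of_output hctrl hd.semiObservable hd.rank_C₂ hd.posDef_S₂ hd.lyapunov
    (v := fun k => mode T (U k) j) (fun k => ?_) (fun k => hbd _ (hU k)) hC ?_
  · rw [hdyn, mode_dynamics]
  · rw [← mul_gain hd.posDef_input]
    simpa [Matrix.mulVec_mulVec] using tendsto_mulVec_zero (Bᵀ * S * B) hg

/-- The disagreement modes of the predicted inputs vanish along the closed loop. -/
theorem tendsto_predicted_input_mode (hd : DesignConditions L W A B C S c α)
    (hb : IsModalBasis L W P T ev) (hev : ∀ j, 0 ≤ ev j)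
    (hdyn : ∀ k (l : Fin N), x k l.succ = ((1 : Matrix (Fin M) (Fin M) ℝ) ⊗ₖ A) *ᵥ x k l.castSucc
      + ((1 : Matrix (Fin M) (Fin M) ℝ) ⊗ₖ B) *ᵥ u k l)
    (hcost : Tendsto (fun k => cost (matQs L W A B C S c α) (matRs L W B S c α) (matSs L W S)
      (x k) (u k)) atTop (𝓝 0)) {j : Fin M} (hj : 0 < ev j) (l : Fin N) :
    Tendsto (fun k => mode T (u k l) j) atTop (𝓝 0) := by
  have hQ0 := wsq_matQs_nonneg hd hb hev
  have hR0 := wsq_matRs_nonneg hd hb hev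
  have hS0 := wsq_matSs_nonneg hd hb hev
  have hsum0 : ∀ k, 0 ≤ ∑ l : Fin N, (wsq (matQs L W A B C S c α) (x k l.castSucc)
      + wsq (matRs L W B S c α) (u k l)) := fun k =>
    Finset.sum_nonneg fun l _ => add_nonneg (hQ0 _) (hR0 _)
  have hS : Tendsto (fun k => wsq (matSs L W S) (x k (Fin.last N))) atTop (𝓝 0) :=
    squeeze_zero (fun k => hS0 _) (fun k => le_add_of_nonneg_left (hsum0 k)) hcost
  have hQ : ∀ l : Fin N, Tendsto (fun k => wsq (matQs L W A B C S c α) (x k l.castSucc)) atTop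
      (𝓝 0) := fun l => by
    refine squeeze_zero (fun k => hQ0 _) (fun k => ?_) hcost
    have h1 := Finset.single_le_sum (f := fun l : Fin N =>
      wsq (matQs L W A B C S c α) (x k l.castSucc) + wsq (matRs L W B S c α) (u k l))
      (fun l _ => add_nonneg (hQ0 _) (hR0 _)) (Finset.mem_univ l)
    have h2 := hS0 (x k (Fin.last N))
    have h3 := hR0 (u k l)
    simp only [cost] at h1 ⊢
    linarith
  have hstep : ∀ l : Fin N, Tendsto (fun k => mode T (x k l.succ) j) atTop (𝓝 0) →
      Tendsto (fun k => mode T (x k l.castSucc) j) atTop (𝓝 0) ∧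
      Tendsto (fun k => mode T (u k l) j) atTop (𝓝 0) := fun l hl => by
    obtain ⟨hC, hg⟩ := tendsto_modes_of_wsq_matQs hd hb hev (hQ l) hj
    exact tendsto_zero_of_successor hd (fun k => by rw [hdyn, mode_dynamics]) hl hC hg
  -- Backwards from the horizon: the terminal weight controls a whole disagreement mode of the last
  -- state, whereas a stage cost controls only its output and feedback term.
  have hx : ∀ l : Fin (N + 1), Tendsto (fun k => mode T (x k l) j) atTop (𝓝 0) := fun l => by
    induction l using Fin.reverseInduction with
    | last => exact tendsto_mode_of_wsq_matSs hd hb hev hS hj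
    | cast l ih => exact (hstep l ih).1
  exact (hstep l (hx l.succ)).2

theorem agent_eq_sum (hb : IsModalBasis L W P T ev) (Y : Fin M × Fin n → ℝ) (i : Fin M) :
    agent Y i = WithLp.toLp 2 (∑ j, P i j • mode T Y j) := by
  rw [agent, hb.apply_eq_sum]

/-- If all modes converge and only those with constant eigenvector have a nonzero limit, then the
agents reach convergent consensus. -/
theorem reachesConvergentConsensus_of_modes (hb : IsModalBasis L W P T ev)
    (hconst : ∀ j, ev j = 0 → ∀ i i', P i j = P i' j)
    {z : Fin M → Fin n → ℝ} (hz : ∀ j, Tendsto (fun k => mode T (X k) j) atTop (𝓝 (z j)))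
    (hz0 : ∀ j, ev j ≠ 0 → z j = 0) : ReachesConvergentConsensus X := by
  have hlim : ∀ i, Tendsto (fun k => agent (X k) i) atTop
      (𝓝 (WithLp.toLp 2 (∑ j, P i j • z j))) := fun i => by
    simp only [agent_eq_sum hb]
    exact ((PiLp.continuous_toLp 2 _).tendsto _).comp
      (tendsto_finsetSum _ fun j _ => (hz j).const_smul (P i j))
  refine ⟨fun i i' => ?_, fun i => ⟨_, (hlim i).norm⟩⟩
  have heq : ∑ j, P i j • z j = ∑ j, P i' j • z j := Finset.sum_congr rfl fun j _ => by
    by_cases hj : ev j = 0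
    · rw [hconst j hj i i']
    · rw [hz0 j hj, smul_zero, smul_zero]
  have h := ((hlim i).sub (hlim i')).norm
  rwa [heq, sub_self, norm_zero] at h

/-- The closed loop under a receding-horizon law reaches convergent consensus. -/
theorem reachesConvergentConsensus_of_isOptimal [NeZero N] (hctrl : IsControllable A B)
    (hd : DesignConditions L W A B C S c α) (hb : IsModalBasis L W P T ev) (hev : ∀ j, 0 ≤ ev j)
    (hconst : ∀ j, ev j = 0 → ∀ i i', P i j = P i' j)
    (hcompact : ∀ i, IsCompact (𝒰 i)) (hzero : ∀ i, (0 : Fin m → ℝ) ∈ interior (𝒰 i))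
    (hβ : 0 < β)
    (hK : IsTerminalController ((1 : Matrix (Fin M) (Fin M) ℝ) ⊗ₖ A)
      ((1 : Matrix (Fin M) (Fin M) ℝ) ⊗ₖ B)
      (matQs L W A B C S c α) (matRs L W B S c α) (matSs L W S) (inputSet 𝒰)
      (levelSet (matSs L W S) β) (matKstar L A B S c α))
    (hloop : IsRHCClosedLoop N ((1 : Matrix (Fin M) (Fin M) ℝ) ⊗ₖ A)
      ((1 : Matrix (Fin M) (Fin M) ℝ) ⊗ₖ B)
      (matQs L W A B C S c α) (matRs L W B S c α) (matSs L W S) (inputSet 𝒰)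
      (levelSet (matSs L W S) β) X U)
    (hopt : ∀ k, IsOptimal ((1 : Matrix (Fin M) (Fin M) ℝ) ⊗ₖ A)
      ((1 : Matrix (Fin M) (Fin M) ℝ) ⊗ₖ B)
      (matQs L W A B C S c α) (matRs L W B S c α) (matSs L W S) (inputSet 𝒰)
      (levelSet (matSs L W S) β) (X k) (x k) (u k) ∧ U k = u k 0) :
    ReachesConvergentConsensus X := by
  have hQ0 := wsq_matQs_nonneg hd hb hev
  have hR0 := wsq_matRs_nonneg hd hb hev
  have hS0 := wsq_matSs_nonneg hd hb hev
  have hstage := hloop.tendsto_stage_cost hK hQ0 hR0 hS0 hopt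
  have hU : ∀ k, U k ∈ inputSet 𝒰 := fun k => (hopt k).2 ▸ (hopt k).1.1.input 0
  have hmode : ∀ j, 0 < ev j → Tendsto (fun k => mode T (X k) j) atTop (𝓝 0) := fun j hj =>
    tendsto_disagreement_mode hctrl hd hb hev hcompact hU hloop.dynamics hstage hj
  have hSX := tendsto_wsq_matSs (S := S) hb hev hmode
  -- Monotonicity alone would allow a positive limit of the optimal cost. Eventually, however, the
  -- state lies in the terminal set, where the terminal controller bounds this cost by the vanishing
  -- terminal weight.
  have hcost : Tendsto (fun k => cost (matQs L W A B C S c α) (matRs L W B S c α) (matSs L W S)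
      (x k) (u k)) atTop (𝓝 0) := by
    have hmem : ∀ᶠ k in atTop, X k ∈ levelSet (matSs L W S) β := by
      have h1 := (Real.continuous_sqrt.tendsto 0).comp hSX
      rw [Real.sqrt_zero] at h1
      exact (h1.eventually (gt_mem_nhds hβ)).mono fun k hk => le_of_lt hk
    refine squeeze_zero' (Eventually.of_forall fun k => ?_) (hmem.mono fun k hk => ?_) hSX
    · exact add_nonneg (Finset.sum_nonneg fun l _ => add_nonneg (hQ0 _) (hR0 _)) (hS0 _)
    · obtain ⟨x', u', hf, hc⟩ := hK.exists_feasible_cost_le N hk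
      exact ((hopt k).1.2 x' u' hf).trans hc
  have hinput := fun j (hj : 0 < ev j) l => tendsto_predicted_input_mode hd hb hev
    (fun k => (hopt k).1.1.dynamics) hcost hj l
  -- After projection every mode of the predicted inputs tends to `0`, so each agent's input enters
  -- a neighbourhood of `0` contained in its constraint set.
  have hproj : ∀ᶠ k in atTop, ∀ l, (disagreementProj P T ev ⊗ₖ (1 : Matrix (Fin m) (Fin m) ℝ))
      *ᵥ u k l ∈ inputSet 𝒰 := by
    refine eventually_all.mpr fun l => eventually_mem_inputSet hb hzero fun j => ?_
    simp only [mode_disagreementProj hb]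
    split_ifs with hj
    · exact tendsto_const_nhds
    · exact hinput j (lt_of_le_of_ne (hev j) (Ne.symm hj)) l
  obtain ⟨k₀, hk₀⟩ := eventually_atTop.mp hproj
  have hlim : ∀ j, ∃ z, Tendsto (fun k => mode T (X k) j) atTop (𝓝 z) ∧ (ev j ≠ 0 → z = 0) := by
    intro j
    by_cases hj : ev j = 0
    · have hfree : ∀ k, mode T (X (k + 1 + k₀)) j = A *ᵥ mode T (X (k + k₀)) j := fun k => by
        rw [show k + 1 + k₀ = k + k₀ + 1 by omega, hloop.dynamics, mode_dynamics, (hopt _).2,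
          mode_eq_zero_of_isOptimal hd hb hev (hopt _).1 (hk₀ _ (by omega)) hj, Matrix.mulVec_zero,
          add_zero]
      obtain ⟨z, hz⟩ := exists_tendsto_free_response hd.semiObservable hd.rank_C₂ hd.posDef_S₂
        hd.lyapunov (y := fun k => mode T (X (k + k₀)) j) hfree
      exact ⟨z, (tendsto_add_atTop_iff_nat k₀).mp hz, fun h => absurd hj h⟩
    · exact ⟨0, hmode j (lt_of_le_of_ne (hev j) (Ne.symm hj)), fun _ => rfl⟩
  choose z hz hz0 using hlim
  exact reachesConvergentConsensus_of_modes hb hconst hz hz0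

end ClosedLoop

end RHCConsensus

theorem theorem5 {M n m p N : ℕ} [NeZero N]
    (G : Digraph (Fin M)) (hloop : ∀ i, ¬ G.Adj i i) (htree : HasSpanningTree G)
    (A : Matrix (Fin n) (Fin n) ℝ) (B : Matrix (Fin n) (Fin m) ℝ)
    (hctrl : IsControllable A B) (hsemi : IsSemistable A)
    (𝒰 : Fin M → Set (Fin m → ℝ)) (hcompact : ∀ i, IsCompact (𝒰 i))
    (hzero : ∀ i, (0 : Fin m → ℝ) ∈ interior (𝒰 i))
    (C₂ : Matrix (Fin p) (Fin n) ℝ) (S₂ : Matrix (Fin n) (Fin n) ℝ)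
    (W : Matrix (Fin M) (Fin M) ℝ) (c α : ℝ)
    (hdesign : DesignConditions (laplacian G) W A B C₂ S₂ c α)
    (β : ℝ) (hβ : 0 < β)
    (hterminal : ∀ X ∈ levelSet (matSs (laplacian G) W S₂) β,
      matKstar (laplacian G) A B S₂ c α *ᵥ X ∈ inputSet 𝒰)
    (X : ℕ → Fin M × Fin n → ℝ) (U : ℕ → Fin M × Fin m → ℝ)
    (hloopRHC : IsRHCClosedLoop N ((1 : Matrix (Fin M) (Fin M) ℝ) ⊗ₖ A)
      ((1 : Matrix (Fin M) (Fin M) ℝ) ⊗ₖ B)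
      (matQs (laplacian G) W A B C₂ S₂ c α) (matRs (laplacian G) W B S₂ c α)
      (matSs (laplacian G) W S₂) (inputSet 𝒰) (levelSet (matSs (laplacian G) W S₂) β) X U)
    (hinit : ∃ (x : Fin (N + 1) → Fin M × Fin n → ℝ) (u : Fin N → Fin M × Fin m → ℝ),
      IsFeasible ((1 : Matrix (Fin M) (Fin M) ℝ) ⊗ₖ A) ((1 : Matrix (Fin M) (Fin M) ℝ) ⊗ₖ B)
        (inputSet 𝒰) (levelSet (matSs (laplacian G) W S₂) β) (X 0) x u) :
    (∀ k, IsRHCInput N ((1 : Matrix (Fin M) (Fin M) ℝ) ⊗ₖ A)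
      ((1 : Matrix (Fin M) (Fin M) ℝ) ⊗ₖ B)
      (matQs (laplacian G) W A B C₂ S₂ c α) (matRs (laplacian G) W B S₂ c α)
      (matSs (laplacian G) W S₂) (inputSet 𝒰) (levelSet (matSs (laplacian G) W S₂) β)
      (X k) (U k)) ∧
    (∀ k i, (fun a => U k (i, a)) ∈ 𝒰 i) ∧
    ReachesConvergentConsensus X := by
  obtain ⟨P, T, ev, h1, h2, h3, h4⟩ := exists_modal_basis hdesign.posDef_W hdesign.symm_WL
  have hb : IsModalBasis (laplacian G) W P T ev := ⟨h1, h2, h3, h4⟩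
  have hev : ∀ j, 0 ≤ ev j := fun j =>
    laplacian_eigenvalue_nonneg (hb.col_ne_zero j) (hb.mulVec_col j)
  -- This is where the spanning tree enters: a consensus mode contributes equally to all agents, so
  -- its limit cancels in differences.
  have hconst : ∀ j, ev j = 0 → ∀ i i', P i j = P i' j := fun j hj =>
    eq_of_laplacian_mulVec_eq_zero (v := P.col j) htree (by rw [hb.mulVec_col, hj, zero_smul])
  have hK := isTerminalController_matKstar hdesign hb hev hterminal
  obtain ⟨x, u, hopt⟩ := hloopRHC.exists_optimal hK hinit
  refine ⟨fun k => ⟨x k, u k, hopt k⟩, fun k => ?_, ?_⟩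
  · rw [(hopt k).2]
    exact (hopt k).1.1.input 0
  · exact reachesConvergentConsensus_of_isOptimal hctrl hdesign hb hev hconst hcompact hzero hβ hK
      hloopRHC hopt
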